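/- For $n\in\mathbb N$ let $B_n=\{-n,\dots,n\}^2\subset\mathbb Z^2$ and $\mathbb S=\mathbb R/2\pi\mathbb Z$. A configuration $\hat\eta$ assigns to each site $x$ either no particle, or one active particle, or one passive particle; a particle at $x$ carries an angle $\theta_x\in\mathbb S$. Write $\eta^a_x,\eta^p_x\in\{0,1\}$ for the numbers of active and passive particles at $x$, $\eta_x=\eta^a_x+\eta^p_x$, and, for $\omega:\mathbb S\to\mathbb R$ and $\sigma\in\{a,p\}$, $\eta^{\sigma,\omega}_x=\omega(\theta_x)\eta^\sigma_x$. A cylinder function is a real function of the configuration on $\mathbb Z^2$ that depends on finitely many sites only and is $C^2$ in each angle. Let $T^\omega$ be the linear span of the cylinder functions of the form $$f(\hat\eta)=\sum_{x\in\mathbb Z^2}\big(a\eta^a_x+b\eta^p_x+c\,\eta^{a,\omega}_x+d\,\eta^{p,\omega}_x\big)F_x(\eta),$$ where $a,b,c,d\in\mathbb R$ and each $F_x$ is independent of the types and the angles of the particles (it sees only which sites are occupied), and let $T^\omega_n$ be the set of those $f\in T^\omega$ that are cylinder functions depending only on the sites of $B_n$. A canonical state $\widehat K=(K^a,\Theta^a,K^p,\Theta^p)$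 on $B_n$ consists of the numbers $K^a,K^p$ of active and passive particles, $K^a+K^p\le|B_n|$, and of the multisets $\Theta^a,\Theta^p$ of their angles. Let $\mu_{n,\widehat K}$ be the canonical measure, i.e. the uniform distribution on the finite set of configurations on $B_n$ whose active (resp. passive) particles have exactly the angles $\Theta^a$ (resp. $\Theta^p$), let $\mathbb E_{n,\widehat K}$ be its expectation, and put $\alpha^\sigma=K^\sigma/|B_n|$. Let $$\mathcal L_nf(\hat\eta)=\sum_{x\in B_n}\ \sum_{|z|=1,\ x+z\in B_n}\eta_x(1-\eta_{x+z})\big(f(\hat\eta^{x,x+z})-f(\hat\eta)\big)$$ be the generator of the symmetric simple exclusion process in $B_n$, where $|\cdot|$ is the Manhattan norm and $\hat\eta^{x,y}$ is $\hat\eta$ with the states of $x$ and $y$ exchanged, and let $\mathcal D_{n,\widehat K}(f)=\mathbb E_{n,\widehat K}[f\,(-\mathcal L_nf)]$. **Proposition 5.6 (spectral gap).** For every $\alpha'\in[0,1)$ there is a constant $C(\alpha')$, depending only on $\alpha'$, such that for every $\omega:\mathbb S\to\mathbb R$, every $n$, every canonical state $\widehat K$ on $B_n$ with $\alpha^a+\alpha^p\le\alpha'$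 and every $f\in T^\omega_n$ with $\mathbb E_{n,\widehat K}[f]=0$, $$\mathbb E_{n,\widehat K}[f^2]\le C(\alpha')\,n^2\,\mathcal D_{n,\widehat K}(f).$$ -/

import Mathlib

namespace APLG

/-- The state of one site: empty, or occupied by an active or a passive particle which carries an
angle in `ℝ / 2πℤ`.  (The default angle `0` of an empty site carries no information.) -/
inductive Site where
  | empty : Site
  | active (θ : Real.Angle) : Site
  | passive (θ : Real.Angle) : Site

namespace Site

/-- Number of active particles, `η^a`. -/
def etaA : Site → ℝ
  | active _ => 1
  | _ => 0

/-- Number of passive particles, `η^p`. -/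
def etaP : Site → ℝ
  | passive _ => 1
  | _ => 0

/-- Total number of particles, `η = η^a + η^p`. -/
def eta (s : Site) : ℝ := s.etaA + s.etaP

/-- The angle, with the convention `0` at an empty site. -/
noncomputable def angle : Site → Real.Angle
  | empty => 0
  | active θ => θ
  | passive θ => θ

/-- The angle of an active particle as a multiset; it stands for the point measure `η^a δ_θ`. -/
def activeAngles : Site → Multiset Real.Angle
  | active θ => {θ}
  | _ => 0

/-- The angle of a passive particle as a multiset; it stands for the point measure `η^p δ_θ`. -/
def passiveAngles : Site → Multiset Real.Angle
  | passive θ => {θ}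
  | _ => 0

end Site

/-- Configurations on a set of sites `ι`. -/
abbrev Config (ι : Type) : Type := ι → Site

/-- Configurations on the infinite lattice `ℤ²`. -/
abbrev ConfigZ2 : Type := Config (ℤ × ℤ)

/-- Local functions which are `C²` in the angle of each particle. -/
def IsCylinder (f : ConfigZ2 → ℝ) : Prop :=
  (∃ s : Finset (ℤ × ℤ), DependsOn f (s : Set (ℤ × ℤ))) ∧
  ∀ (η : ConfigZ2) (x : ℤ × ℤ),
    ContDiff ℝ 2 (fun t : ℝ => f (Function.update η x (Site.active (t : Real.Angle)))) ∧
    ContDiff ℝ 2 (fun t : ℝ => f (Function.update η x (Site.passive (t : Real.Angle))))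

/-- `F` is independent of type and angle at `x`. -/
def IsITA (x : ℤ × ℤ) (F : ConfigZ2 → ℝ) : Prop :=
  ∃ f g : ConfigZ2 → ℝ, DependsOn f ({x}ᶜ : Set (ℤ × ℤ)) ∧
    ∀ η, F η = (η x).eta * f η + (1 - (η x).eta) * g η

/-- The angle-blind and type-blind functions. -/
def blindFunctions : Set (ConfigZ2 → ℝ) := {F | ∀ x, IsITA x F}

/-- The class `T^ω`: the span of the cylinder functions of the form
`∑_x (a η^a_x + b η^p_x + c η^{a,ω}_x + d η^{p,ω}_x) F_x(η)` with `F_x` angle- and type-blind. -/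
def classT (ω : Real.Angle → ℝ) : Submodule ℝ (ConfigZ2 → ℝ) :=
  Submodule.span ℝ {f | IsCylinder f ∧
    ∃ (a b c d : ℝ) (F : ℤ × ℤ → ConfigZ2 → ℝ), (∀ x, F x ∈ blindFunctions) ∧
      ∀ η : ConfigZ2, HasSum (fun x : ℤ × ℤ =>
        (a * (η x).etaA + b * (η x).etaP
          + c * (ω (η x).angle * (η x).etaA) + d * (ω (η x).angle * (η x).etaP)) * F x η) (f η)}

/-- The box `B_n = {-n, …, n}²` of side length `2n+1`. -/
noncomputable def box (n : ℕ) : Finset (ℤ × ℤ) := Finset.Icc (-(n : ℤ), -(n : ℤ)) ((n : ℤ), (n : ℤ))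

/-- The class `T^ω_n` of the functions of `T^ω` that are cylinder functions supported in `B_n`. -/
def classTn (ω : Real.Angle → ℝ) (n : ℕ) : Set (ConfigZ2 → ℝ) :=
  {f | f ∈ classT ω ∧ IsCylinder f ∧ DependsOn f (box n : Set (ℤ × ℤ))}

/-- The image on `B_n`-configurations of a function on the infinite configurations: sites outside
`B_n` are taken to be empty (they are irrelevant to a function supported in `B_n`). -/
noncomputable def onBox (n : ℕ) (f : ConfigZ2 → ℝ) (η : Config (box n)) : ℝ :=
  f (fun x => if h : x ∈ box n then η ⟨x, h⟩ else Site.empty)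

/-- A canonical state in `B_n`: the angles, with multiplicity, of the active and of the passive
particles; the particle numbers are the cardinalities. -/
structure CanonicalState (n : ℕ) where
  thetaA : Multiset Real.Angle
  thetaP : Multiset Real.Angle
  card_le : thetaA.card + thetaP.card ≤ (box n).card

namespace CanonicalState

variable {n : ℕ}

/-- The density `α^a` of active particles. -/
noncomputable def alphaA (K : CanonicalState n) : ℝ := (K.thetaA.card : ℝ) / ((box n).card : ℝ)

/-- The density `α^p` of passive particles. -/
noncomputable def alphaP (K : CanonicalState n) : ℝ := (K.thetaP.card : ℝ) / ((box n).card : ℝ)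

/-- The hyperplane of the configurations on `B_n` with canonical state `K`. -/
def hyperplane (K : CanonicalState n) : Set (Config (box n)) :=
  {η | ∑ x, (η x).activeAngles = K.thetaA ∧ ∑ x, (η x).passiveAngles = K.thetaP}

theorem hyperplane_finite (K : CanonicalState n) : K.hyperplane.Finite := by
  classical
  have hfin : (({Site.empty} ∪ Site.active '' {θ | θ ∈ K.thetaA}) ∪
      Site.passive '' {θ | θ ∈ K.thetaP} : Set Site).Finite := by
    refine ((Set.finite_singleton _).union (Set.Finite.image _ ?_)).union (Set.Finite.image _ ?_)
    · exact (Multiset.finite_toSet K.thetaA)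
    · exact (Multiset.finite_toSet K.thetaP)
  refine (Set.Finite.pi' (fun _ : box n => hfin)).subset ?_
  rintro η ⟨ha, hp⟩ x
  have h1 : (η x).activeAngles ≤ K.thetaA := by
    rw [← ha]
    exact Finset.single_le_sum (f := fun y => (η y).activeAngles) (fun _ _ => Multiset.zero_le _)
      (Finset.mem_univ x)
  have h2 : (η x).passiveAngles ≤ K.thetaP := by
    rw [← hp]
    exact Finset.single_le_sum (f := fun y => (η y).passiveAngles) (fun _ _ => Multiset.zero_le _)
      (Finset.mem_univ x)
  cases hx : η x with
  | empty => exact Or.inl (Or.inl rfl)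
  | active θ =>
    rw [hx] at h1
    exact Or.inl (Or.inr ⟨θ, Multiset.singleton_le.mp h1, rfl⟩)
  | passive θ =>
    rw [hx] at h2
    exact Or.inr ⟨θ, Multiset.singleton_le.mp h2, rfl⟩

theorem hyperplane_nonempty (K : CanonicalState n) : K.hyperplane.Nonempty := by
  classical
  set M : Multiset Site := K.thetaA.map Site.active + K.thetaP.map Site.passive
    + Multiset.replicate ((box n).card - (K.thetaA.card + K.thetaP.card)) Site.empty with hM
  have hcard : M.toList.length = Fintype.card (box n) := by
    have := K.card_le
    simp [hM]
    omega
  let e : box n ≃ Fin M.toList.length := Fintype.equivFinOfCardEq hcard.symm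
  have key : ∀ g : Site → Multiset Real.Angle,
      ∑ x, g (M.toList.get (e x)) = (M.map g).sum := by
    intro g
    rw [Equiv.sum_comp e (fun i => g (M.toList.get i))]
    conv_rhs => rw [← Multiset.coe_toList M, Multiset.map_coe, Multiset.sum_coe]
    rw [← List.sum_ofFn]
    congr 1
    apply List.ext_get <;> simp
  refine ⟨fun x => M.toList.get (e x), ?_, ?_⟩
  · rw [key, hM]
    simp [Function.comp_def, Site.activeAngles]
  · rw [key, hM]
    simp [Function.comp_def, Site.passiveAngles]

/-- Expectation under the canonical measure, which is the uniform distribution on the (finite,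
non-empty) hyperplane: the i.i.d. measure with uniform angles, conditioned on the hyperplane. -/
noncomputable def expect (K : CanonicalState n) (g : Config (box n) → ℝ) : ℝ :=
  (∑ η ∈ K.hyperplane_finite.toFinset, g η) / (K.hyperplane_finite.toFinset.card : ℝ)

end CanonicalState

/-- Nearest neighbours: Manhattan distance `1`. -/
def Neighbour (x y : ℤ × ℤ) : Prop := |y.1 - x.1| + |y.2 - x.2| = 1

instance (x y : ℤ × ℤ) : Decidable (Neighbour x y) :=
  inferInstanceAs (Decidable (|y.1 - x.1| + |y.2 - x.2| = 1))

/-- The generator `L_n` of the symmetric simple exclusion process restricted to jumps with both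
extremities in `B_n`. -/
noncomputable def generator (n : ℕ) (g : Config (box n) → ℝ) (η : Config (box n)) : ℝ :=
  ∑ x : box n, ∑ y : box n,
    if Neighbour x.1 y.1 then
      (η x).eta * (1 - (η y).eta) * (g (η ∘ Equiv.swap x y) - g η)
    else 0

/-- The Dirichlet form `⟨g, -L_n g⟩` with respect to the canonical measure. -/
noncomputable def dirichletForm {n : ℕ} (K : CanonicalState n) (g : Config (box n) → ℝ) : ℝ :=
  K.expect (fun η => g η * -(generator n g η))

end APLG

/-!
Fix a configuration `ξ` of the hyperplane. The canonical measure is the law of `ξ ∘ τ⁻¹`, with `τ` a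
uniform permutation of the box, and a function of `T^ω` becomes a sum `∑ i ∈ P, m i i τ` over the
set `P` of the labels of the particles, where `m i k τ` depends only on the particle `i`, on the
position `τ k` and on the set of the occupied sites. Centring the rows and the columns of the
matrix `m` splits off a function of the occupied sites alone. By exchangeability the centred terms
of different particles are nearly orthogonal, in `L²` and in the Dirichlet form, up to a factor `2`;
hence it is enough to prove the inequality for a function of the position of a single tagged
particle and of the occupied sites.

For a tagged particle at `x`, transpositions of the contents of two other sites are compared with
nearest-neighbour exchanges which avoid `x`, along paths of the grid minus `x`. The tag itself
moves from `x` to a neighbour `y` by an exchange with a hole docked at `y`, and the hole is brought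
back to the other side of the tag along a detour. As the holes are interchangeable, one hole
carries at most the fraction `1 / #Pᶜ` of the energy, and `#Pᶜ ≥ (1 - α') |B_n|`.
-/

namespace APLG

open Finset Equiv

/-- A quasi-distance on `S`: symmetric, zero on the diagonal, and subject to a triangle inequality
which has a factor `2` on one side only, so that a path costs at most twice the sum of its steps. -/
structure IsQuasiDist {V : Type*} (S : Set V) (s : V → V → ℝ) : Prop where
  nonneg : ∀ p q, 0 ≤ s p q
  symm : ∀ p ∈ S, ∀ q ∈ S, s p q = s q p
  self : ∀ p ∈ S, s p p = 0
  tri : ∀ p ∈ S, ∀ q ∈ S, ∀ r ∈ S, s p r ≤ s p q + 2 * s q r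

theorem IsQuasiDist.comap {V W : Type*} {S : Set V} {s : V → V → ℝ} (hs : IsQuasiDist S s)
    {T : Set W} (φ : W → V) (hφ : ∀ w ∈ T, φ w ∈ S) :
    IsQuasiDist T (fun p q => s (φ p) (φ q)) where
  nonneg _ _ := hs.nonneg _ _
  symm p hp q hq := hs.symm _ (hφ p hp) _ (hφ q hq)
  self p hp := hs.self _ (hφ p hp)
  tri p hp q hq r hr := hs.tri _ (hφ p hp) _ (hφ q hq) _ (hφ r hr)

theorem IsQuasiDist.comap_update {V : Type*} [DecidableEq V] {x x' : V} {s : V → V → ℝ}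
    (hs : IsQuasiDist {x}ᶜ s) (hx' : x' ≠ x) : IsQuasiDist Set.univ
      (fun p q => s (Function.update id x x' p) (Function.update id x x' q)) := by
  refine hs.comap _ fun w _ => ?_
  by_cases h : w = x
  · simpa [h] using hx'
  · simp [h]

section Chain

variable {l m : ℤ} {t : ℤ → ℤ → ℝ}

theorem IsQuasiDist.le_sum_Ico (ht : IsQuasiDist (Set.Icc l m) t) {a b : ℤ} (ha : l ≤ a)
    (hab : a ≤ b) (hb : b ≤ m) : t a b ≤ 2 * ∑ k ∈ Ico a b, t k (k + 1) := by
  induction b, hab using Int.leInduction with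
  | base => simp [ht.self a ⟨ha, hb⟩]
  | succ b hab ih =>
    have hstep := ht.tri a ⟨ha, by omega⟩ b ⟨by omega, by omega⟩ (b + 1) ⟨by omega, hb⟩
    have hIco : Ico a (b + 1) = insert b (Ico a b) := by
      ext k; simp only [mem_Ico, mem_insert]; omega
    rw [hIco, sum_insert (by simp)]
    linarith [ih (by omega)]

theorem IsQuasiDist.le_sum_steps (ht : IsQuasiDist (Set.Icc l m) t) {a b : ℤ}
    (ha : a ∈ Set.Icc l m) (hb : b ∈ Set.Icc l m) : t a b ≤ 2 * ∑ k ∈ Ico l m, t k (k + 1) := by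
  wlog hab : a ≤ b generalizing a b
  · exact (ht.symm a ha b hb).trans_le (this hb ha (le_of_not_ge hab))
  refine (ht.le_sum_Ico ha.1 hab hb.2).trans ?_
  gcongr
  exacts [fun _ _ _ => ht.nonneg _ _, ha.1, hb.2]

theorem IsQuasiDist.sq_le_sum_sq_steps (ht : IsQuasiDist (Set.Icc l m) t) {a b : ℤ}
    (ha : a ∈ Set.Icc l m) (hb : b ∈ Set.Icc l m) :
    t a b ^ 2 ≤ 4 * (m - l) * ∑ k ∈ Ico l m, t k (k + 1) ^ 2 := by
  have hcard : (#(Ico l m) : ℝ) = m - l := by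
    rw [Int.card_Ico]
    exact_mod_cast Int.toNat_of_nonneg (sub_nonneg.2 (ha.1.trans ha.2))
  calc t a b ^ 2 ≤ (2 * ∑ k ∈ Ico l m, t k (k + 1)) ^ 2 :=
        pow_le_pow_left₀ (ht.nonneg a b) (ht.le_sum_steps ha hb) 2
    _ = 4 * (∑ k ∈ Ico l m, t k (k + 1)) ^ 2 := by ring
    _ ≤ 4 * (#(Ico l m) * ∑ k ∈ Ico l m, t k (k + 1) ^ 2) := by
        gcongr; exact sq_sum_le_card_mul_sum_sq
    _ = 4 * (m - l) * ∑ k ∈ Ico l m, t k (k + 1) ^ 2 := by rw [hcard]; ring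

end Chain

open Classical in
/-- The sum of the squares of `s` over the oriented bonds of the relation `R` inside `S`. -/
noncomputable def energy {V : Type*} [Fintype V] (R : V → V → Prop) (S : Set V)
    (s : V → V → ℝ) : ℝ :=
  ∑ p, ∑ q, if R p q ∧ p ∈ S ∧ q ∈ S then s p q ^ 2 else 0

section Energy

variable {V : Type*} [Fintype V] {R : V → V → Prop} {S : Set V}

theorem energy_nonneg (S : Set V) (s : V → V → ℝ) : 0 ≤ energy R S s :=
  sum_nonneg fun _ _ => sum_nonneg fun _ _ => by split_ifs <;> positivity

theorem energy_congr {s t : V → V → ℝ} (h : ∀ p ∈ S, ∀ q ∈ S, s p q = t p q) :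
    energy R S s = energy R S t := by
  refine sum_congr rfl fun p _ => sum_congr rfl fun q _ => ?_
  split_ifs with hpq
  · rw [h p hpq.2.1 q hpq.2.2]
  · rfl

theorem sum_sq_le_energy_of_injOn {ι : Type*} {A : Finset ι} {e : ι → V × V}
    (he : Set.InjOn e A) (hR : ∀ i ∈ A, R (e i).1 (e i).2)
    (hS : ∀ i ∈ A, (e i).1 ∈ S ∧ (e i).2 ∈ S) (s : V → V → ℝ) :
    ∑ i ∈ A, s (e i).1 (e i).2 ^ 2 ≤ energy R S s := by
  classical
  have henergy : energy R S s
      = ∑ b : V × V with R b.1 b.2 ∧ b.1 ∈ S ∧ b.2 ∈ S, s b.1 b.2 ^ 2 := by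
    rw [sum_filter, Fintype.sum_prod_type, energy]
  rw [henergy, ← sum_image (f := fun b : V × V => s b.1 b.2 ^ 2) he]
  refine sum_le_sum_of_subset_of_nonneg (image_subset_iff.2 fun i hi => ?_) fun _ _ _ => sq_nonneg _
  simpa only [mem_filter_univ] using ⟨hR i hi, hS i hi⟩

theorem le_sqrt_energy (s : V → V → ℝ) {p q : V} (h : R p q) (hp : p ∈ S) (hq : q ∈ S) :
    s p q ≤ √(energy R S s) := by
  refine Real.le_sqrt_of_sq_le ?_
  simpa using sum_sq_le_energy_of_injOn (A := {(p, q)}) (e := id) (S := S) (R := R)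
    (Function.injective_id.injOn) (by simpa) (by simpa using ⟨hp, hq⟩) s

theorem energy_univ [DecidableRel R] (s : V → V → ℝ) :
    energy R Set.univ s = ∑ p, ∑ q, if R p q then s p q ^ 2 else 0 := by
  simp only [energy, Set.mem_univ, and_self, and_true]

theorem energy_compl [DecidableEq V] [DecidableRel R] (x : V) (s : V → V → ℝ) :
    energy R {x}ᶜ s = ∑ p, ∑ q, if R p q ∧ p ≠ x ∧ q ≠ x then s p q ^ 2 else 0 := by
  simp only [energy, Set.mem_compl_iff, Set.mem_singleton_iff, ← ne_eq]

theorem energy_univ_eq_energy_compl_add [DecidableRel R] (hR : ∀ p q, R p q → R q p)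
    (hirr : ∀ p, ¬ R p p) {s : V → V → ℝ} (hs : ∀ p q, s p q = s q p) (x : V) :
    energy R Set.univ s = energy R {x}ᶜ s + 2 * ∑ q with R x q, s x q ^ 2 := by
  classical
  have hsplit : ∀ p q, (if R p q then s p q ^ 2 else 0) =
      (if R p q ∧ p ≠ x ∧ q ≠ x then s p q ^ 2 else 0)
        + ((if p = x then if R x q then s x q ^ 2 else 0 else 0)
          + if q = x then if R x p then s x p ^ 2 else 0 else 0) := by
    intro p q
    by_cases hp : p = x
    · subst hp
      by_cases hq : q = p
      · simp [hq, hirr]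
      · simp [hq]
    · by_cases hq : q = x
      · subst hq
        simp [hp, hs p q, show R p q ↔ R q p from ⟨hR p q, hR q p⟩]
      · simp [hp, hq]
  rw [energy_univ, energy_compl, sum_congr rfl fun p _ => sum_congr rfl fun q _ => hsplit p q]
  simp only [sum_add_distrib, sum_ite_irrel, sum_const_zero, Fintype.sum_ite_eq',
    sum_filter, two_mul]

end Energy

/-- The nearest-neighbour relation of the box. -/
abbrev boxAdj (n : ℕ) (p q : box n) : Prop := Neighbour p.1 q.1

theorem Neighbour.symm {x y : ℤ × ℤ} (h : Neighbour x y) : Neighbour y x := by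
  unfold Neighbour at *
  rwa [abs_sub_comm x.1, abs_sub_comm x.2]

theorem Neighbour.ne {x y : ℤ × ℤ} (h : Neighbour x y) : x ≠ y := by
  rintro rfl
  simp [Neighbour] at h

theorem neighbour_iff {x y : ℤ × ℤ} : Neighbour x y ↔
    y = (x.1 + 1, x.2) ∨ y = (x.1 - 1, x.2) ∨ y = (x.1, x.2 + 1) ∨ y = (x.1, x.2 - 1) := by
  simp only [Neighbour, Prod.ext_iff]
  rcases abs_cases (y.1 - x.1) with h₁ | h₁ <;> rcases abs_cases (y.2 - x.2) with h₂ | h₂ <;> omega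

section Grid

variable {n : ℕ}

theorem mem_box {x : ℤ × ℤ} :
    x ∈ box n ↔ x.1 ∈ Set.Icc (-(n : ℤ)) n ∧ x.2 ∈ Set.Icc (-(n : ℤ)) n := by
  simp only [box, Finset.mem_Icc, Set.mem_Icc, Prod.le_def]
  tauto

theorem box_eq_product (n : ℕ) :
    box n = Finset.Icc (-(n : ℤ)) n ×ˢ Finset.Icc (-(n : ℤ)) n := by
  ext x; simp [mem_box]

theorem card_Icc_neg (n : ℕ) : #(Finset.Icc (-(n : ℤ)) n) = 2 * n + 1 := by
  rw [Int.card_Icc]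
  omega

theorem card_box (n : ℕ) : #(box n) = (2 * n + 1) ^ 2 := by
  rw [box_eq_product, card_product, card_Icc_neg, sq]

/-- The point of the box with given coordinates (the centre, if they are out of range). -/
noncomputable def boxPt (n : ℕ) (a b : ℤ) : box n :=
  if h : (a, b) ∈ box n then ⟨(a, b), h⟩ else ⟨(0, 0), by simp [mem_box]⟩

theorem boxPt_val {a b : ℤ} (ha : a ∈ Set.Icc (-(n : ℤ)) n) (hb : b ∈ Set.Icc (-(n : ℤ)) n) :
    (boxPt n a b).1 = (a, b) := by
  rw [boxPt, dif_pos (mem_box.2 ⟨ha, hb⟩)]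

theorem boxPt_coord (p : box n) : boxPt n p.1.1 p.1.2 = p := by
  simp [boxPt, p.2]

theorem fst_mem_Icc (p : box n) : p.1.1 ∈ Set.Icc (-(n : ℤ)) n := (mem_box.1 p.2).1

theorem snd_mem_Icc (p : box n) : p.1.2 ∈ Set.Icc (-(n : ℤ)) n := (mem_box.1 p.2).2

theorem sum_box_eq_sum_product (F : ℤ × ℤ → ℝ) :
    ∑ p : box n, F p.1
      = ∑ a ∈ Finset.Icc (-(n : ℤ)) n, ∑ b ∈ Finset.Icc (-(n : ℤ)) n, F (a, b) := by
  rw [← sum_product', ← box_eq_product, sum_coe_sort]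

theorem sum_box_fst (F : ℤ → ℝ) :
    ∑ p : box n, F p.1.1 = (2 * n + 1) * ∑ a ∈ Finset.Icc (-(n : ℤ)) n, F a := by
  rw [sum_box_eq_sum_product fun p => F p.1]
  simp only [sum_const, card_Icc_neg, nsmul_eq_mul, mul_sum]
  push_cast; rfl

theorem sum_box_snd (F : ℤ → ℝ) :
    ∑ p : box n, F p.1.2 = (2 * n + 1) * ∑ b ∈ Finset.Icc (-(n : ℤ)) n, F b := by
  rw [sum_box_eq_sum_product fun p => F p.2]
  simp only [sum_const, card_Icc_neg, nsmul_eq_mul]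
  push_cast; rfl

variable (s : box n → box n → ℝ)

/-- The energy of the row of height `b`. -/
noncomputable def rowEnergy (b : ℤ) : ℝ :=
  ∑ k ∈ Ico (-(n : ℤ)) n, s (boxPt n k b) (boxPt n (k + 1) b) ^ 2

/-- The energy of the column of abscissa `a`. -/
noncomputable def colEnergy (a : ℤ) : ℝ :=
  ∑ k ∈ Ico (-(n : ℤ)) n, s (boxPt n a k) (boxPt n a (k + 1)) ^ 2

theorem rowEnergy_nonneg (b : ℤ) : 0 ≤ rowEnergy s b := sum_nonneg fun _ _ => sq_nonneg _

theorem colEnergy_nonneg (a : ℤ) : 0 ≤ colEnergy s a := sum_nonneg fun _ _ => sq_nonneg _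

theorem sum_rowEnergy_le :
    ∑ b ∈ Finset.Icc (-(n : ℤ)) n, rowEnergy s b ≤ energy (boxAdj n) Set.univ s := by
  have hval : ∀ i ∈ Finset.Icc (-(n : ℤ)) n ×ˢ Ico (-(n : ℤ)) n,
      (boxPt n i.2 i.1).1 = (i.2, i.1) ∧ (boxPt n (i.2 + 1) i.1).1 = (i.2 + 1, i.1) := by
    rintro ⟨b, k⟩ h
    simp only [mem_product, Finset.mem_Icc, mem_Ico] at h
    exact ⟨boxPt_val ⟨h.2.1, by omega⟩ h.1, boxPt_val ⟨by omega, by omega⟩ h.1⟩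
  simp only [rowEnergy]
  rw [← sum_product']
  refine sum_sq_le_energy_of_injOn (R := boxAdj n) (S := Set.univ)
    (e := fun i : ℤ × ℤ => (boxPt n i.2 i.1, boxPt n (i.2 + 1) i.1))
    (fun i hi j hj hij => ?_) (fun i hi => ?_) (fun _ _ => ⟨trivial, trivial⟩) s
  · have := congrArg (fun e => e.1.1) hij
    simp only [(hval i hi).1, (hval j hj).1, Prod.mk.injEq] at this
    exact Prod.ext this.2 this.1
  · simp [neighbour_iff, hval i hi]

theorem sum_colEnergy_le :
    ∑ a ∈ Finset.Icc (-(n : ℤ)) n, colEnergy s a ≤ energy (boxAdj n) Set.univ s := by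
  have hval : ∀ i ∈ Finset.Icc (-(n : ℤ)) n ×ˢ Ico (-(n : ℤ)) n,
      (boxPt n i.1 i.2).1 = (i.1, i.2) ∧ (boxPt n i.1 (i.2 + 1)).1 = (i.1, i.2 + 1) := by
    rintro ⟨a, k⟩ h
    simp only [mem_product, Finset.mem_Icc, mem_Ico] at h
    exact ⟨boxPt_val h.1 ⟨h.2.1, by omega⟩, boxPt_val h.1 ⟨by omega, by omega⟩⟩
  simp only [colEnergy]
  rw [← sum_product']
  refine sum_sq_le_energy_of_injOn (R := boxAdj n) (S := Set.univ)
    (e := fun i : ℤ × ℤ => (boxPt n i.1 i.2, boxPt n i.1 (i.2 + 1)))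
    (fun i hi j hj hij => ?_) (fun i hi => ?_) (fun _ _ => ⟨trivial, trivial⟩) s
  · have := congrArg (fun e => e.1.1) hij
    simp only [(hval i hi).1, (hval j hj).1] at this
    exact this
  · simp [neighbour_iff, hval i hi]

variable {s}

theorem IsQuasiDist.sq_le_rowEnergy (hs : IsQuasiDist Set.univ s) (p : box n) {a : ℤ}
    (ha : a ∈ Set.Icc (-(n : ℤ)) n) :
    s p (boxPt n a p.1.2) ^ 2 ≤ 8 * n * rowEnergy s p.1.2 := by
  have hrow := hs.comap (T := Set.Icc (-(n : ℤ)) n) (fun a => boxPt n a p.1.2) fun _ _ => trivial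
  calc s p (boxPt n a p.1.2) ^ 2
      ≤ 4 * ((n : ℤ) - (-n : ℤ)) * rowEnergy s p.1.2 := by
        simpa only [boxPt_coord, rowEnergy] using hrow.sq_le_sum_sq_steps (fst_mem_Icc p) ha
    _ = 8 * n * rowEnergy s p.1.2 := by push_cast; ring

theorem IsQuasiDist.sq_le_colEnergy (hs : IsQuasiDist Set.univ s) (q : box n) {b : ℤ}
    (hb : b ∈ Set.Icc (-(n : ℤ)) n) :
    s (boxPt n q.1.1 b) q ^ 2 ≤ 8 * n * colEnergy s q.1.1 := by
  have hcol := hs.comap (T := Set.Icc (-(n : ℤ)) n) (boxPt n q.1.1) fun _ _ => trivial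
  calc s (boxPt n q.1.1 b) q ^ 2
      ≤ 4 * ((n : ℤ) - (-n : ℤ)) * colEnergy s q.1.1 := by
        simpa only [boxPt_coord, colEnergy] using hcol.sq_le_sum_sq_steps hb (snd_mem_Icc q)
    _ = 8 * n * colEnergy s q.1.1 := by push_cast; ring

theorem IsQuasiDist.sq_le_row_add_col (hs : IsQuasiDist Set.univ s) (p q : box n) :
    s p q ^ 2 ≤ 64 * n * (rowEnergy s p.1.2 + colEnergy s q.1.1) := by
  set c := boxPt n q.1.1 p.1.2
  have hrow : s p c ^ 2 ≤ 8 * n * rowEnergy s p.1.2 := hs.sq_le_rowEnergy p (fst_mem_Icc q)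
  have hcol : s c q ^ 2 ≤ 8 * n * colEnergy s q.1.1 := hs.sq_le_colEnergy q (snd_mem_Icc p)
  have hrow₀ : 0 ≤ n * rowEnergy s p.1.2 := mul_nonneg n.cast_nonneg (rowEnergy_nonneg s _)
  calc s p q ^ 2 ≤ (s p c + 2 * s c q) ^ 2 :=
        pow_le_pow_left₀ (hs.nonneg p q) (hs.tri p trivial c trivial q trivial) 2
    _ ≤ 2 * (s p c ^ 2 + 4 * s c q ^ 2) := by nlinarith [sq_nonneg (s p c - 2 * s c q)]
    _ ≤ 64 * n * (rowEnergy s p.1.2 + colEnergy s q.1.1) := by linarith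

theorem IsQuasiDist.sq_le_energy_univ (hs : IsQuasiDist Set.univ s) (p q : box n) :
    s p q ^ 2 ≤ 128 * n * energy (boxAdj n) Set.univ s := by
  have hrow : rowEnergy s p.1.2 ≤ energy (boxAdj n) Set.univ s :=
    (single_le_sum (f := rowEnergy s) (fun _ _ => rowEnergy_nonneg s _)
      (Finset.mem_Icc.2 (snd_mem_Icc p))).trans (sum_rowEnergy_le s)
  have hcol : colEnergy s q.1.1 ≤ energy (boxAdj n) Set.univ s :=
    (single_le_sum (f := colEnergy s) (fun _ _ => colEnergy_nonneg s _)
      (Finset.mem_Icc.2 (fst_mem_Icc q))).trans (sum_colEnergy_le s)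
  calc s p q ^ 2 ≤ 64 * n * (rowEnergy s p.1.2 + colEnergy s q.1.1) := hs.sq_le_row_add_col p q
    _ ≤ 64 * n * (energy (boxAdj n) Set.univ s + energy (boxAdj n) Set.univ s) := by gcongr
    _ = 128 * n * energy (boxAdj n) Set.univ s := by ring

theorem IsQuasiDist.sum_sq_le_energy_univ (hn : 1 ≤ n) (hs : IsQuasiDist Set.univ s) :
    ∑ p, ∑ q, s p q ^ 2 ≤ 3456 * (n : ℝ) ^ 4 * energy (boxAdj n) Set.univ s := by
  have hn' : (2 * n + 1 : ℝ) ≤ 3 * n := by norm_cast; omega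
  have hE := energy_nonneg (R := boxAdj n) Set.univ s
  calc ∑ p, ∑ q, s p q ^ 2
      ≤ ∑ p : box n, ∑ q : box n, 64 * n * (rowEnergy s p.1.2 + colEnergy s q.1.1) :=
        sum_le_sum fun p _ => sum_le_sum fun q _ => hs.sq_le_row_add_col p q
    _ = 64 * n * (2 * n + 1) ^ 3 * (∑ b ∈ Finset.Icc (-(n : ℤ)) n, rowEnergy s b
        + ∑ a ∈ Finset.Icc (-(n : ℤ)) n, colEnergy s a) := by
        simp only [← mul_sum, sum_add_distrib, sum_const, card_univ, Fintype.card_coe, card_box,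
          sum_box_fst, sum_box_snd, nsmul_eq_mul]
        push_cast; ring
    _ ≤ 64 * n * (2 * n + 1) ^ 3
        * (energy (boxAdj n) Set.univ s + energy (boxAdj n) Set.univ s) := by
        gcongr
        · exact sum_rowEnergy_le s
        · exact sum_colEnergy_le s
    _ ≤ 64 * n * (3 * n) ^ 3
        * (energy (boxAdj n) Set.univ s + energy (boxAdj n) Set.univ s) := by gcongr
    _ = 3456 * (n : ℝ) ^ 4 * energy (boxAdj n) Set.univ s := by ring

theorem exists_horizontal_neighbour (hn : 1 ≤ n) (x : box n) :
    ∃ y : box n, boxAdj n x y ∧ y.1.2 = x.1.2 := by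
  obtain ⟨⟨x₁, x₂⟩, hx⟩ := x
  have hx' := mem_box.1 hx
  simp only [Set.mem_Icc] at hx'
  rcases le_or_gt (x₁ + 1) n with h | h
  · exact ⟨⟨(x₁ + 1, x₂), mem_box.2 ⟨⟨by omega, h⟩, hx'.2⟩⟩, by simp [neighbour_iff], rfl⟩
  · exact ⟨⟨(x₁ - 1, x₂), mem_box.2 ⟨⟨by omega, by omega⟩, hx'.2⟩⟩, by simp [neighbour_iff], rfl⟩

theorem exists_vertical_neighbour (hn : 1 ≤ n) (x : box n) :
    ∃ y : box n, boxAdj n x y ∧ y.1.1 = x.1.1 := by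
  obtain ⟨⟨x₁, x₂⟩, hx⟩ := x
  have hx' := mem_box.1 hx
  simp only [Set.mem_Icc] at hx'
  rcases le_or_gt (x₂ + 1) n with h | h
  · exact ⟨⟨(x₁, x₂ + 1), mem_box.2 ⟨hx'.1, ⟨by omega, h⟩⟩⟩, by simp [neighbour_iff], rfl⟩
  · exact ⟨⟨(x₁, x₂ - 1), mem_box.2 ⟨hx'.1, ⟨by omega, by omega⟩⟩⟩, by simp [neighbour_iff], rfl⟩

theorem IsQuasiDist.le_sqrt_energy_corner {x p q : box n} (hs : IsQuasiDist {x}ᶜ s)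
    (hp : boxAdj n x p) (hph : p.1.2 = x.1.2) (hq : boxAdj n x q) (hqv : q.1.1 = x.1.1) :
    s p q ≤ 3 * √(energy (boxAdj n) {x}ᶜ s) := by
  obtain ⟨⟨x₁, x₂⟩, hx⟩ := x
  obtain ⟨⟨p₁, p₂⟩, hpbox⟩ := p
  obtain ⟨⟨q₁, q₂⟩, hqbox⟩ := q
  obtain rfl : p₂ = x₂ := hph
  obtain rfl : q₁ = x₁ := hqv
  let c : box n := ⟨(p₁, q₂), mem_box.2 ⟨(mem_box.1 hpbox).1, (mem_box.1 hqbox).2⟩⟩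
  simp only [boxAdj, Neighbour, sub_self, abs_zero, add_zero, zero_add] at hp hq
  have hpx : p₁ ≠ q₁ := by rintro rfl; simp at hp
  have hqx : q₂ ≠ p₂ := by rintro rfl; simp at hq
  have hpc := le_sqrt_energy (R := boxAdj n) (S := {⟨(q₁, p₂), hx⟩}ᶜ) s
    (p := ⟨(p₁, p₂), hpbox⟩) (q := c) (by simpa [c, Neighbour]) (by simp [hpx]) (by simp [c, hpx])
  have hcq := le_sqrt_energy (R := boxAdj n) (S := {⟨(q₁, p₂), hx⟩}ᶜ) s
    (p := c) (q := ⟨(q₁, q₂), hqbox⟩) (by simpa [c, Neighbour, abs_sub_comm] using hp)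
    (by simp [c, hpx]) (by simp [hqx])
  linarith [hs.tri ⟨(p₁, p₂), hpbox⟩ (by simp [hpx]) c (by simp [c, hpx]) ⟨(q₁, q₂), hqbox⟩
    (by simp [hqx])]

theorem IsQuasiDist.le_sqrt_energy_detour (hn : 1 ≤ n) {x p q : box n}
    (hs : IsQuasiDist {x}ᶜ s) (hp : boxAdj n x p) (hq : boxAdj n x q) :
    s p q ≤ 9 * √(energy (boxAdj n) {x}ᶜ s) := by
  have hne : ∀ y, boxAdj n x y → y ∈ ({x}ᶜ : Set (box n)) := fun y hy h =>
    hy.ne (congrArg Subtype.val h.symm)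
  have haxis : ∀ y, boxAdj n x y → y.1.2 = x.1.2 ∨ y.1.1 = x.1.1 := fun y hy => by
    rcases neighbour_iff.1 hy with h | h | h | h <;> simp [h]
  have hcorner : ∀ y z, boxAdj n x y → y.1.2 = x.1.2 → boxAdj n x z → z.1.1 = x.1.1 →
      s y z ≤ 3 * √(energy (boxAdj n) {x}ᶜ s) ∧ s z y ≤ 3 * √(energy (boxAdj n) {x}ᶜ s) :=
    fun y z hy hyh hz hzv => ⟨hs.le_sqrt_energy_corner hy hyh hz hzv,
      hs.symm y (hne y hy) z (hne z hz) ▸ hs.le_sqrt_energy_corner hy hyh hz hzv⟩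
  obtain ⟨h, hh, hhh⟩ := exists_horizontal_neighbour hn x
  obtain ⟨v, hv, hvv⟩ := exists_vertical_neighbour hn x
  have htri := fun y hy => hs.tri p (hne p hp) y (hne y hy) q (hne q hq)
  have he := Real.sqrt_nonneg (energy (boxAdj n) {x}ᶜ s)
  rcases haxis p hp with hp' | hp' <;> rcases haxis q hq with hq' | hq'
  · linarith [htri v hv, hcorner p v hp hp' hv hvv, hcorner q v hq hq' hv hvv]
  · linarith [hcorner p q hp hp' hq hq']
  · linarith [hcorner q p hq hq' hp hp']
  · linarith [htri h hh, hcorner h p hh hhh hp hp', hcorner h q hh hhh hq hq']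

theorem card_neighbours_le (x : box n) : #{q : box n | boxAdj n x q} ≤ 4 := by
  rw [← card_map (Function.Embedding.subtype _)]
  refine (card_le_card (t := {(x.1.1 + 1, x.1.2), (x.1.1 - 1, x.1.2), (x.1.1, x.1.2 + 1),
    (x.1.1, x.1.2 - 1)}) fun y hy => ?_).trans card_le_four
  simp only [mem_map, mem_filter_univ, Function.Embedding.subtype_apply] at hy
  obtain ⟨q, hq, rfl⟩ := hy
  simpa only [mem_insert, mem_singleton] using neighbour_iff.1 hq

end Grid

section GridLike

variable {V : Type*} [Fintype V] {R : V → V → Prop} [DecidableRel R] {n : ℕ} {κ : ℝ}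

/-- The geometry of a box of side of order `n` in `ℤ²`, up to a constant `κ`: the inequalities for
quasi-distances express that any two points, resp. all pairs of points, are joined by paths of
length and congestion as in the box, and that two neighbours of a point `x` are joined by a path
of bounded length which avoids `x`. -/
structure IsGridLike (R : V → V → Prop) [DecidableRel R] (n : ℕ) (κ : ℝ) : Prop where
  one_le : 1 ≤ n
  four_mul_sq_lt_card : 4 * n ^ 2 < Fintype.card V
  symm : ∀ p q, R p q → R q p
  irrefl : ∀ p, ¬ R p p
  exists_adj : ∀ x, ∃ y, R x y
  card_adj_le : ∀ x, (#{y | R x y} : ℝ) ≤ κ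
  sq_le : ∀ s : V → V → ℝ, IsQuasiDist Set.univ s → ∀ p q,
    s p q ^ 2 ≤ κ * n * energy R Set.univ s
  sum_sq_le : ∀ s : V → V → ℝ, IsQuasiDist Set.univ s →
    ∑ p, ∑ q, s p q ^ 2 ≤ κ * n ^ 4 * energy R Set.univ s
  sq_le_detour : ∀ (x : V) (s : V → V → ℝ), IsQuasiDist {x}ᶜ s → ∀ p q, R x p → R x q →
    s p q ^ 2 ≤ κ * energy R {x}ᶜ s

theorem isGridLike_boxAdj {n : ℕ} (hn : 1 ≤ n) : IsGridLike (boxAdj n) n 3456 where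
  one_le := hn
  four_mul_sq_lt_card := by
    rw [Fintype.card_coe, card_box]
    linarith
  symm _ _ h := h.symm
  irrefl _ h := h.ne rfl
  exists_adj x := (exists_horizontal_neighbour hn x).imp fun _ h => h.1
  card_adj_le x := by
    have : (#{q : box n | boxAdj n x q} : ℝ) ≤ 4 := by exact_mod_cast card_neighbours_le x
    linarith
  sq_le s hs p q := by
    refine (hs.sq_le_energy_univ p q).trans ?_
    gcongr
    · exact energy_nonneg _ _
    · norm_num
  sum_sq_le _ hs := hs.sum_sq_le_energy_univ hn
  sq_le_detour x s hs p q hp hq := by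
    have hE := energy_nonneg (R := boxAdj n) {x}ᶜ s
    calc s p q ^ 2 ≤ (9 * √(energy (boxAdj n) {x}ᶜ s)) ^ 2 :=
          pow_le_pow_left₀ (hs.nonneg p q) (hs.le_sqrt_energy_detour hn hp hq) 2
      _ = 81 * energy (boxAdj n) {x}ᶜ s := by rw [mul_pow, Real.sq_sqrt hE]; norm_num
      _ ≤ 3456 * energy (boxAdj n) {x}ᶜ s := by linarith

theorem IsGridLike.constant_nonneg [Nonempty V] (hG : IsGridLike R n κ) : 0 ≤ κ :=
  (Nat.cast_nonneg _).trans (hG.card_adj_le (Classical.arbitrary V))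

theorem IsGridLike.ne (hG : IsGridLike R n κ) {p q : V} (h : R p q) : q ≠ p := by
  rintro rfl
  exact hG.irrefl _ h

section Retraction

variable {x x' : V} {s : V → V → ℝ}

/-- Moving `x` to one of its neighbours `x'` makes a quasi-distance off `x` one on the whole grid;
only the bonds at `x` change, and they become detours around `x`. -/
theorem IsGridLike.energy_comap_update_le [DecidableEq V] (hG : IsGridLike R n κ)
    (hs : IsQuasiDist {x}ᶜ s) (hx' : R x x') :
    energy R Set.univ (fun p q => s (Function.update id x x' p) (Function.update id x x' q))
      ≤ (1 + 2 * κ ^ 2) * energy R {x}ᶜ s := by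
  have : Nonempty V := ⟨x⟩
  have hκ := hG.constant_nonneg
  have hE := energy_nonneg (R := R) {x}ᶜ s
  have hqd := hs.comap_update (hG.ne hx')
  have hoff : energy R {x}ᶜ
      (fun p q => s (Function.update id x x' p) (Function.update id x x' q)) = energy R {x}ᶜ s :=
    energy_congr fun p hp q hq => by
      rw [Function.update_of_ne hp, Function.update_of_ne hq, id, id]
  have hbonds : ∑ q with R x q,
      s (Function.update id x x' x) (Function.update id x x' q) ^ 2
        ≤ κ * (κ * energy R {x}ᶜ s) := by
    refine (sum_le_card_nsmul _ _ (κ * energy R {x}ᶜ s) fun q hq => ?_).trans ?_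
    · have hxq : R x q := by simpa using hq
      rw [Function.update_self, Function.update_of_ne (hG.ne hxq), id]
      exact hG.sq_le_detour x s hs x' q hx' hxq
    · rw [nsmul_eq_mul]
      exact mul_le_mul_of_nonneg_right (hG.card_adj_le x) (mul_nonneg hκ hE)
  rw [energy_univ_eq_energy_compl_add hG.symm hG.irrefl
    (fun p q => hqd.symm p trivial q trivial) x, hoff]
  linarith

theorem IsGridLike.sq_le_compl (hG : IsGridLike R n κ) (hs : IsQuasiDist {x}ᶜ s) {p q : V}
    (hp : p ≠ x) (hq : q ≠ x) :
    s p q ^ 2 ≤ κ * (1 + 2 * κ ^ 2) * n * energy R {x}ᶜ s := by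
  classical
  have : Nonempty V := ⟨x⟩
  have hκ := hG.constant_nonneg
  obtain ⟨x', hx'⟩ := hG.exists_adj x
  calc s p q ^ 2 = s (Function.update id x x' p) (Function.update id x x' q) ^ 2 := by
        rw [Function.update_of_ne hp, Function.update_of_ne hq, id, id]
    _ ≤ κ * n * energy R Set.univ
          (fun p q => s (Function.update id x x' p) (Function.update id x x' q)) :=
        hG.sq_le _ (hs.comap_update (hG.ne hx')) p q
    _ ≤ κ * n * ((1 + 2 * κ ^ 2) * energy R {x}ᶜ s) := by
        gcongr; exact hG.energy_comap_update_le hs hx'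
    _ = κ * (1 + 2 * κ ^ 2) * n * energy R {x}ᶜ s := by ring

theorem IsGridLike.sum_sq_le_compl [DecidableEq V] (hG : IsGridLike R n κ)
    (hs : IsQuasiDist {x}ᶜ s) :
    ∑ p, ∑ q, (if p ≠ x ∧ q ≠ x then s p q ^ 2 else 0)
      ≤ κ * (1 + 2 * κ ^ 2) * n ^ 4 * energy R {x}ᶜ s := by
  have : Nonempty V := ⟨x⟩
  have hκ := hG.constant_nonneg
  obtain ⟨x', hx'⟩ := hG.exists_adj x
  calc ∑ p, ∑ q, (if p ≠ x ∧ q ≠ x then s p q ^ 2 else 0)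
      ≤ ∑ p, ∑ q, s (Function.update id x x' p) (Function.update id x x' q) ^ 2 := by
        refine sum_le_sum fun p _ => sum_le_sum fun q _ => ?_
        split_ifs with h
        · rw [Function.update_of_ne h.1, Function.update_of_ne h.2, id, id]
        · positivity
    _ ≤ κ * n ^ 4 * energy R Set.univ
          (fun p q => s (Function.update id x x' p) (Function.update id x x' q)) :=
        hG.sum_sq_le _ (hs.comap_update (hG.ne hx'))
    _ ≤ κ * n ^ 4 * ((1 + 2 * κ ^ 2) * energy R {x}ᶜ s) := by
        gcongr; exact hG.energy_comap_update_le hs hx'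
    _ = κ * (1 + 2 * κ ^ 2) * n ^ 4 * energy R {x}ᶜ s := by ring

end Retraction

theorem isQuasiDist_abs_sub {V : Type*} (S : Set V) (u : V → ℝ) :
    IsQuasiDist S fun p q => |u p - u q| where
  nonneg _ _ := abs_nonneg _
  symm _ _ _ _ := abs_sub_comm _ _
  self _ _ := by simp
  tri p _ q _ r _ := by linarith [abs_sub_le (u p) (u q) (u r), abs_nonneg (u q - u r)]

/-- The pair `(x, k x)` moves to `(y, k y)` by moving `k x` to `y` around `x`, exchanging `x` and
`y`, and moving `x` to `k y` around `y`. -/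
theorem IsGridLike.sq_docked_le (hG : IsGridLike R n κ) (U : V → V → ℝ) {k : V → V}
    (hk : ∀ x, R x (k x)) {x y : V} (hxy : R x y) :
    (U x (k x) - U y (k y)) ^ 2 ≤ 3 * κ * energy R {x}ᶜ (fun h v => |U x h - U x v|)
      + 3 * κ * energy R {y}ᶜ (fun h v => |U y h - U y v|) + 3 * (U x y - U y x) ^ 2 := by
  have hdetour : ∀ x p q, R x p → R x q →
      (U x p - U x q) ^ 2 ≤ κ * energy R {x}ᶜ (fun h v => |U x h - U x v|) := fun x p q hp hq => by
    simpa only [sq_abs] using hG.sq_le_detour x _ (isQuasiDist_abs_sub {x}ᶜ (U x)) p q hp hq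
  have hx := hdetour x (k x) y (hk x) hxy
  have hy := hdetour y x (k y) (hG.symm _ _ hxy) (hk y)
  have hsplit : (U x (k x) - U y (k y)) ^ 2 ≤
      3 * ((U x (k x) - U x y) ^ 2 + (U x y - U y x) ^ 2 + (U y x - U y (k y)) ^ 2) := by
    nlinarith [sq_nonneg ((U x (k x) - U x y) - (U x y - U y x)),
      sq_nonneg ((U x (k x) - U x y) - (U y x - U y (k y))),
      sq_nonneg ((U x y - U y x) - (U y x - U y (k y)))]
  linarith

theorem IsGridLike.sum_sq_docked_le [Nonempty V] (hG : IsGridLike R n κ) (U : V → V → ℝ)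
    {k : V → V} (hk : ∀ x, R x (k x)) :
    ∑ x, ∑ y, (U x (k x) - U y (k y)) ^ 2 ≤ κ * n ^ 4 *
      (6 * κ ^ 2 * ∑ x, energy R {x}ᶜ (fun h v => |U x h - U x v|)
        + 3 * ∑ x, ∑ y, (if R x y then (U x y - U y x) ^ 2 else 0)) := by
  have hκ := hG.constant_nonneg
  set E : V → ℝ := fun x => energy R {x}ᶜ (fun h v => |U x h - U x v|)
  have hdegree : ∑ x, ∑ y, (if R x y then E x else 0) ≤ κ * ∑ x, E x := by
    rw [mul_sum]
    refine sum_le_sum fun x _ => ?_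
    rw [← sum_filter, sum_const, nsmul_eq_mul]
    exact mul_le_mul_of_nonneg_right (hG.card_adj_le x) (energy_nonneg _ _)
  have hreverse : ∑ x, ∑ y, (if R x y then E y else 0) = ∑ x, ∑ y, (if R x y then E x else 0) := by
    rw [sum_comm]
    refine sum_congr rfl fun x _ => sum_congr rfl fun y _ => ?_
    simp only [show R x y ↔ R y x from ⟨hG.symm _ _, hG.symm _ _⟩]
  have hbonds : energy R Set.univ (fun x y => |U x (k x) - U y (k y)|) ≤
      3 * κ * ∑ x, ∑ y, (if R x y then E x else 0) + 3 * κ * ∑ x, ∑ y, (if R x y then E y else 0)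
        + 3 * ∑ x, ∑ y, (if R x y then (U x y - U y x) ^ 2 else 0) := by
    simp only [energy_univ, sq_abs, mul_sum, ← sum_add_distrib]
    refine sum_le_sum fun x _ => sum_le_sum fun y _ => ?_
    split_ifs with hxy
    · exact hG.sq_docked_le U hk hxy
    · simp
  have hpoincare := hG.sum_sq_le _ (isQuasiDist_abs_sub Set.univ fun x => U x (k x))
  simp only [sq_abs] at hpoincare
  refine hpoincare.trans ?_
  gcongr
  refine hbonds.trans ?_
  rw [hreverse]
  nlinarith [mul_le_mul_of_nonneg_left hdegree hκ]

end GridLike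

section Permutations

theorem sum_sum_sum_erase {V : Type*} [DecidableEq V] (g : V → V → ℝ) (T : Finset V) :
    ∑ u ∈ T, ∑ a ∈ T.erase u, ∑ b ∈ (T.erase u).erase a, g a b
      = (#T - 2) * ∑ a ∈ T, ∑ b ∈ T.erase a, g a b := by
  rw [sum_comm' (t' := T) (s' := fun a => T.erase a) (by simp only [mem_erase]; tauto), mul_sum]
  refine sum_congr rfl fun a ha => ?_
  rw [sum_comm' (t' := T.erase a) (s' := fun b => (T.erase a).erase b)
    (by simp only [mem_erase]; tauto), mul_sum]
  refine sum_congr rfl fun b hb => ?_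
  rw [sum_const, nsmul_eq_mul, cast_card_erase_of_mem hb, cast_card_erase_of_mem ha]
  ring

variable {V : Type*} [Fintype V] [DecidableEq V] {S T : Finset V} {ρ σ : Perm V} {u : V}

/-- The permutations which move no point outside `S`. -/
def permsOn (S : Finset V) : Finset (Perm V) := {ρ | ∀ i, i ∉ S → ρ i = i}

theorem mem_permsOn : ρ ∈ permsOn S ↔ ∀ i, i ∉ S → ρ i = i := by simp [permsOn]

theorem one_mem_permsOn (S : Finset V) : (1 : Perm V) ∈ permsOn S := mem_permsOn.2 fun _ _ => rfl

theorem mul_mem_permsOn (hρ : ρ ∈ permsOn S) (hσ : σ ∈ permsOn S) : ρ * σ ∈ permsOn S :=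
  mem_permsOn.2 fun i hi => by
    rw [Perm.mul_apply, mem_permsOn.1 hσ i hi, mem_permsOn.1 hρ i hi]

theorem inv_mem_permsOn (hρ : ρ ∈ permsOn S) : ρ⁻¹ ∈ permsOn S :=
  mem_permsOn.2 fun i hi => by rw [Perm.inv_eq_iff_eq, mem_permsOn.1 hρ i hi]

theorem swap_mem_permsOn {v : V} (hu : u ∈ S) (hv : v ∈ S) : swap u v ∈ permsOn S :=
  mem_permsOn.2 fun _ hi =>
    swap_apply_of_ne_of_ne (ne_of_mem_of_not_mem hu hi).symm (ne_of_mem_of_not_mem hv hi).symm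

theorem permsOn_mono (h : S ⊆ T) : permsOn S ⊆ permsOn T := fun _ hρ =>
  mem_permsOn.2 fun i hi => mem_permsOn.1 hρ i fun hiS => hi (h hiS)

theorem card_permsOn_pos (S : Finset V) : (0 : ℝ) < #(permsOn S) := by
  exact_mod_cast card_pos.2 ⟨1, one_mem_permsOn S⟩

theorem permsOn_empty : permsOn (∅ : Finset V) = {1} := by
  ext ρ; simp [mem_permsOn, Equiv.ext_iff]

theorem apply_mem_of_mem_permsOn (hρ : ρ ∈ permsOn S) {i : V} (hi : i ∈ S) : ρ i ∈ S := by
  by_contra h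
  exact h (by rwa [ρ.injective (mem_permsOn.1 hρ _ h)])

theorem sum_apply_permsOn (hρ : ρ ∈ permsOn S) (g : V → ℝ) : ∑ v ∈ S, g (ρ v) = ∑ v ∈ S, g v :=
  sum_nbij' (fun v => ρ v) (fun v => ρ⁻¹ v) (fun _ hv => apply_mem_of_mem_permsOn hρ hv)
    (fun _ hv => apply_mem_of_mem_permsOn (inv_mem_permsOn hρ) hv) (by simp) (by simp)
    fun _ _ => rfl

theorem sum_permsOn_insert (hu : u ∉ S) (F : Perm V → ℝ) :
    ∑ ρ ∈ permsOn (insert u S), F ρ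
      = ∑ v ∈ insert u S, ∑ ρ ∈ permsOn S, F (swap u v * ρ) := by
  have hmono : permsOn S ⊆ permsOn (insert u S) := permsOn_mono (subset_insert u S)
  rw [← sum_product']
  refine (sum_nbij' (fun p => swap u p.1 * p.2) (fun ρ => (ρ u, swap u (ρ u) * ρ))
    ?_ ?_ ?_ ?_ fun _ _ => rfl).symm
  · rintro ⟨v, ρ⟩ h
    rw [mem_product] at h
    exact mul_mem_permsOn (swap_mem_permsOn (mem_insert_self _ _) h.1) (hmono h.2)
  · intro ρ hρ
    have hρu : ρ u ∈ insert u S := apply_mem_of_mem_permsOn hρ (mem_insert_self _ _)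
    refine mem_product.2 ⟨hρu, mem_permsOn.2 fun i hi => ?_⟩
    by_cases hiu : i = u
    · simp [hiu]
    · have hi' : i ∉ insert u S := by simp [hi, hiu]
      rw [Perm.mul_apply, mem_permsOn.1 hρ i hi']
      exact mem_permsOn.1 (swap_mem_permsOn (mem_insert_self _ _) hρu) i hi'
  · rintro ⟨v, ρ⟩ h
    have hρu : ρ u = u := mem_permsOn.1 (mem_product.1 h).2 u hu
    simp [hρu]
  · simp

theorem card_permsOn_insert (hu : u ∉ S) :
    (#(permsOn (insert u S)) : ℝ) = #(insert u S) * #(permsOn S) := by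
  simpa using sum_permsOn_insert hu fun _ => 1

/-- The average of `f` over the permutations of the labels in `S`, that is, its conditional
expectation given the positions of the other labels. -/
noncomputable def permAvg (S : Finset V) (f : Perm V → ℝ) (τ : Perm V) : ℝ :=
  (∑ ρ ∈ permsOn S, f (τ * ρ)) / #(permsOn S)

theorem permAvg_empty (f : Perm V → ℝ) : permAvg ∅ f = f := by
  ext τ; simp [permAvg, permsOn_empty]

theorem permAvg_insert (hu : u ∉ S) (f : Perm V → ℝ) (τ : Perm V) :
    permAvg (insert u S) f τ
      = (∑ v ∈ insert u S, permAvg S f (τ * swap u v)) / #(insert u S) := by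
  simp only [permAvg]
  rw [sum_permsOn_insert hu, card_permsOn_insert hu, ← sum_div, div_div,
    mul_comm (#(permsOn S) : ℝ)]
  simp only [mul_assoc]

theorem permAvg_mul (hσ : σ ∈ permsOn S) (f : Perm V → ℝ) (τ : Perm V) :
    permAvg S f (τ * σ) = permAvg S f τ := by
  simp only [permAvg, mul_assoc]
  congr 1
  exact sum_nbij' (fun ρ => σ * ρ) (fun ρ => σ⁻¹ * ρ) (fun _ hρ => mul_mem_permsOn hσ hρ)
    (fun _ hρ => mul_mem_permsOn (inv_mem_permsOn hσ) hρ) (by simp) (by simp) fun _ _ => rfl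

theorem sum_permAvg_mul (f : Perm V → ℝ) {k : Perm V → ℝ}
    (hk : ∀ σ ∈ permsOn S, ∀ τ, k (τ * σ) = k τ) :
    ∑ τ, permAvg S f τ * k τ = ∑ τ, f τ * k τ := by
  have hshift : ∀ ρ ∈ permsOn S, ∑ τ, f (τ * ρ) * k τ = ∑ τ, f τ * k τ := fun ρ hρ => by
    rw [← Equiv.sum_comp (Equiv.mulRight ρ) fun τ => f τ * k τ]
    simp only [Equiv.coe_mulRight, hk ρ hρ]
  simp only [permAvg, div_mul_eq_mul_div, sum_mul]
  rw [← sum_div, sum_comm, sum_congr rfl hshift, sum_const, nsmul_eq_mul,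
    mul_div_cancel_left₀ _ (card_permsOn_pos S).ne']

theorem sum_sq_sub_permAvg_of_subset (h : S ⊆ T) (f : Perm V → ℝ) :
    ∑ τ, (f τ - permAvg T f τ) ^ 2
      = ∑ τ, (f τ - permAvg S f τ) ^ 2 + ∑ τ, (permAvg S f τ - permAvg T f τ) ^ 2 := by
  have hinv : ∀ σ ∈ permsOn S, ∀ τ, permAvg S f (τ * σ) - permAvg T f (τ * σ)
      = permAvg S f τ - permAvg T f τ := fun σ hσ τ => by
    rw [permAvg_mul hσ, permAvg_mul (permsOn_mono h hσ)]
  have hcross := sum_permAvg_mul f (k := fun τ => permAvg S f τ - permAvg T f τ) hinv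
  have hexpand : ∀ τ, (f τ - permAvg T f τ) ^ 2
      = (f τ - permAvg S f τ) ^ 2 + (permAvg S f τ - permAvg T f τ) ^ 2
        + 2 * (f τ * (permAvg S f τ - permAvg T f τ)
          - permAvg S f τ * (permAvg S f τ - permAvg T f τ)) := fun τ => by ring
  rw [sum_congr rfl fun τ _ => hexpand τ, sum_add_distrib, sum_add_distrib, ← mul_sum,
    sum_sub_distrib, hcross]
  ring

/-- The sum of the squares of the increments of `f` along the exchange of the labels `u`, `v`. -/
noncomputable def swapEnergy (f : Perm V → ℝ) (u v : V) : ℝ :=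
  ∑ τ, (f (τ * swap u v) - f τ) ^ 2

theorem swapEnergy_nonneg (f : Perm V → ℝ) (u v : V) : 0 ≤ swapEnergy f u v :=
  sum_nonneg fun _ _ => sq_nonneg _

theorem swapEnergy_permAvg_le (hu : u ∉ S) (f : Perm V → ℝ) (v : V) :
    swapEnergy (permAvg S f) u v
      ≤ (∑ ρ ∈ permsOn S, swapEnergy f u (ρ⁻¹ v)) / #(permsOn S) := by
  have hcomm : ∀ ρ ∈ permsOn S, ∀ τ, τ * swap u v * ρ = τ * ρ * swap u (ρ⁻¹ v) :=
    fun ρ hρ τ => by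
      rw [mul_assoc, swap_mul_eq_mul_swap, mem_permsOn.1 (inv_mem_permsOn hρ) u hu, mul_assoc]
  have hincr : ∀ τ, permAvg S f (τ * swap u v) - permAvg S f τ
      = (∑ ρ ∈ permsOn S, (f (τ * ρ * swap u (ρ⁻¹ v)) - f (τ * ρ))) / #(permsOn S) := fun τ => by
    simp only [permAvg]
    rw [← sub_div, ← sum_sub_distrib, sum_congr rfl fun ρ hρ => by rw [hcomm ρ hρ τ]]
  calc swapEnergy (permAvg S f) u v
      ≤ ∑ τ : Perm V, (∑ ρ ∈ permsOn S,
          (f (τ * ρ * swap u (ρ⁻¹ v)) - f (τ * ρ)) ^ 2) / #(permsOn S) :=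
        sum_le_sum fun τ _ => by rw [hincr]; exact sum_div_card_sq_le_sum_sq_div_card
    _ = (∑ ρ ∈ permsOn S, swapEnergy f u (ρ⁻¹ v)) / #(permsOn S) := by
        rw [← sum_div, sum_comm]
        congr 1
        exact sum_congr rfl fun ρ _ =>
          Equiv.sum_comp (Equiv.mulRight ρ) fun τ => (f (τ * swap u (ρ⁻¹ v)) - f τ) ^ 2

theorem sum_swapEnergy_permAvg_le (hu : u ∉ S) (f : Perm V → ℝ) :
    ∑ v ∈ S, swapEnergy (permAvg S f) u v ≤ ∑ v ∈ S, swapEnergy f u v :=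
  calc ∑ v ∈ S, swapEnergy (permAvg S f) u v
      ≤ ∑ v ∈ S, (∑ ρ ∈ permsOn S, swapEnergy f u (ρ⁻¹ v)) / #(permsOn S) :=
        sum_le_sum fun v _ => swapEnergy_permAvg_le hu f v
    _ = (∑ ρ ∈ permsOn S, ∑ v ∈ S, swapEnergy f u (ρ⁻¹ v)) / #(permsOn S) := by
        rw [← sum_div, sum_comm]
    _ = ∑ v ∈ S, swapEnergy f u v := by
        rw [sum_congr rfl fun ρ hρ => sum_apply_permsOn (inv_mem_permsOn hρ) (swapEnergy f u),
          sum_const, nsmul_eq_mul, mul_div_cancel_left₀ _ (card_permsOn_pos S).ne']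

theorem sum_sq_permAvg_sub_permAvg_insert_le (hu : u ∉ S) (f : Perm V → ℝ) :
    ∑ τ, (permAvg S f τ - permAvg (insert u S) f τ) ^ 2
      ≤ (∑ v ∈ S, swapEnergy f u v) / #(insert u S) := by
  have hcard : (#(insert u S) : ℝ) ≠ 0 := by
    exact_mod_cast (card_pos.2 (insert_nonempty u S)).ne'
  have hincr : ∀ τ, permAvg (insert u S) f τ - permAvg S f τ
      = (∑ v ∈ insert u S, (permAvg S f (τ * swap u v) - permAvg S f τ)) / #(insert u S) :=
    fun τ => by
      rw [permAvg_insert hu, sum_sub_distrib, sum_const, nsmul_eq_mul, sub_div,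
        mul_div_cancel_left₀ _ hcard]
  calc ∑ τ, (permAvg S f τ - permAvg (insert u S) f τ) ^ 2
      ≤ ∑ τ : Perm V, (∑ v ∈ insert u S,
          (permAvg S f (τ * swap u v) - permAvg S f τ) ^ 2) / #(insert u S) :=
        sum_le_sum fun τ _ => by
          rw [← neg_sub, neg_sq, hincr]; exact sum_div_card_sq_le_sum_sq_div_card
    _ = (∑ v ∈ S, swapEnergy (permAvg S f) u v) / #(insert u S) := by
        rw [← sum_div, sum_comm, sum_insert hu, show (swap u u : Perm V) = 1 from swap_self u]
        simp [swapEnergy]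
    _ ≤ (∑ v ∈ S, swapEnergy f u v) / #(insert u S) := by
        exact div_le_div_of_nonneg_right (sum_swapEnergy_permAvg_le hu f) (Nat.cast_nonneg _)

/-- The Poincaré inequality of the random transpositions of the labels in `T`. -/
theorem sum_sq_sub_permAvg_le (f : Perm V → ℝ) (T : Finset V) :
    #T * ∑ τ, (f τ - permAvg T f τ) ^ 2 ≤ ∑ u ∈ T, ∑ v ∈ T.erase u, swapEnergy f u v := by
  induction hT : #T generalizing T with
  | zero => simp [card_eq_zero.1 hT]
  | succ m ih =>
    set W := ∑ τ, (f τ - permAvg T f τ) ^ 2 with hW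
    set Q := ∑ u ∈ T, ∑ v ∈ T.erase u, swapEnergy f u v with hQ
    have hQ0 : 0 ≤ Q := sum_nonneg fun _ _ => sum_nonneg fun _ _ => swapEnergy_nonneg _ _ _
    have hstep : ∀ u ∈ T, W ≤ ∑ τ, (f τ - permAvg (T.erase u) f τ) ^ 2
        + (∑ v ∈ T.erase u, swapEnergy f u v) / ((m + 1 : ℕ) : ℝ) := fun u hu => by
      have hincr := sum_sq_permAvg_sub_permAvg_insert_le (notMem_erase u T) f
      rw [insert_erase hu, hT] at hincr
      rw [hW, sum_sq_sub_permAvg_of_subset (erase_subset u T)]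
      gcongr
    rcases Nat.eq_zero_or_pos m with rfl | hm
    · obtain ⟨u, rfl⟩ := card_eq_one.1 hT
      have hW0 : W ≤ 0 := by simpa [permAvg_empty] using hstep u (mem_singleton_self u)
      push_cast
      linarith
    have : (0 : ℝ) < m := by exact_mod_cast hm
    have hmul : ∀ u ∈ T, m * (m + 1) * W
        ≤ (m + 1) * (∑ a ∈ T.erase u, ∑ b ∈ (T.erase u).erase a, swapEnergy f a b)
          + m * ∑ v ∈ T.erase u, swapEnergy f u v := fun u hu => by
      have hih := ih (T.erase u) (by rw [card_erase_of_mem hu, hT, Nat.add_sub_cancel])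
      have hstep_u := mul_le_mul_of_nonneg_left (hstep u hu) (by positivity : 0 ≤ m * (m + 1 : ℝ))
      push_cast at hstep_u
      calc _ ≤ _ := hstep_u
        _ = (m + 1) * (m * ∑ τ, (f τ - permAvg (T.erase u) f τ) ^ 2)
            + m * ∑ v ∈ T.erase u, swapEnergy f u v := by field_simp
        _ ≤ _ := by gcongr
    have hsum := sum_le_sum hmul
    rw [sum_const, nsmul_eq_mul, sum_add_distrib, ← mul_sum, ← mul_sum, sum_sum_sum_erase, ← hQ,
      hT] at hsum
    push_cast at hsum ⊢
    refine le_of_mul_le_mul_left ?_ (by positivity : 0 < m * (m + 1 : ℝ))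
    linarith

end Permutations

section Tagged

variable {V : Type*} [Fintype V] [DecidableEq V] {P : Finset V} {i₀ : V} {Φ : Perm V → ℝ}

/-- `Φ` depends on the positions of the labels only through the position of the label `i₀` and
the set of the positions of the labels in `P`. -/
def IsTagged {V : Type*} (P : Finset V) (i₀ : V) (Φ : Perm V → ℝ) : Prop :=
  ∀ ρ : Perm V, (∀ i, ρ i ∈ P ↔ i ∈ P) → ρ i₀ = i₀ → ∀ τ, Φ (τ * ρ) = Φ τ

theorem swap_apply_mem_iff {α : Type*} [DecidableEq α] {P : Finset α} {a b : α}
    (h : a ∈ P ↔ b ∈ P) (i : α) : swap a b i ∈ P ↔ i ∈ P := by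
  rw [swap_apply_def]
  split_ifs with ha hb
  · rw [ha, h]
  · rw [hb, h]
  · rfl

theorem IsTagged.swap_mul {V : Type*} [DecidableEq V] {P : Finset V} {i₀ : V} {Φ : Perm V → ℝ}
    (hΦ : IsTagged P i₀ Φ) {τ : Perm V} {p q : V} (hp : p ≠ τ i₀) (hq : q ≠ τ i₀)
    (h : τ⁻¹ p ∈ P ↔ τ⁻¹ q ∈ P) : Φ (swap p q * τ) = Φ τ := by
  have hne : ∀ {r}, r ≠ τ i₀ → i₀ ≠ τ⁻¹ r := fun hr => by
    rwa [ne_comm, Ne, Perm.inv_eq_iff_eq]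
  rw [swap_mul_eq_mul_swap]
  exact hΦ _ (swap_apply_mem_iff h) (swap_apply_of_ne_of_ne (hne hp) (hne hq)) τ

/-- The sum of the squares of the increments of `Φ` over the jumps of a particle (a label in `P`)
to a neighbouring hole (a label outside `P`). -/
noncomputable def jumpEnergy (R : V → V → Prop) [DecidableRel R] (P : Finset V)
    (Φ : Perm V → ℝ) : ℝ :=
  ∑ τ : Perm V, ∑ u : V, ∑ v : V,
    if R u v ∧ τ⁻¹ u ∈ P ∧ τ⁻¹ v ∉ P then (Φ (swap u v * τ) - Φ τ) ^ 2 else 0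

theorem jumpEnergy_nonneg (R : V → V → Prop) [DecidableRel R] (P : Finset V) (Φ : Perm V → ℝ) :
    0 ≤ jumpEnergy R P Φ :=
  sum_nonneg fun _ _ => sum_nonneg fun _ _ => sum_nonneg fun _ _ => by split_ifs <;> positivity

theorem sqrt_sum_sq_add_le {ι : Type*} (s : Finset ι) (f g : ι → ℝ) :
    √(∑ i ∈ s, (f i + g i) ^ 2) ≤ √(∑ i ∈ s, f i ^ 2) + √(∑ i ∈ s, g i ^ 2) := by
  simpa only [Real.rpow_two, sq_abs, ← Real.sqrt_eq_rpow] using Real.Lp_add_le s f g one_le_two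

/-- The `L²` distance of `Φ` and its translate by `σ` on the event that the tag `i₀` is at `x`. -/
noncomputable def translateDist (i₀ : V) (Φ : Perm V → ℝ) (x : V) (σ : Perm V) : ℝ :=
  √(∑ τ : Perm V with τ i₀ = x, (Φ (σ * τ) - Φ τ) ^ 2)

theorem translateDist_nonneg (i₀ : V) (Φ : Perm V → ℝ) (x : V) (σ : Perm V) :
    0 ≤ translateDist i₀ Φ x σ := Real.sqrt_nonneg _

theorem translateDist_mul_le (i₀ : V) (Φ : Perm V → ℝ) {x : V} (σ : Perm V) {ρ : Perm V}
    (hρ : ρ x = x) :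
    translateDist i₀ Φ x (σ * ρ) ≤ translateDist i₀ Φ x σ + translateDist i₀ Φ x ρ := by
  have hshift : ∑ τ : Perm V with τ i₀ = x, (Φ (σ * (ρ * τ)) - Φ (ρ * τ)) ^ 2
      = ∑ τ : Perm V with τ i₀ = x, (Φ (σ * τ) - Φ τ) ^ 2 := by
    refine sum_equiv (Equiv.mulLeft ρ) (fun τ => ?_) fun τ _ => rfl
    simp only [mem_filter_univ, Equiv.coe_mulLeft, Perm.mul_apply]
    conv_rhs => rw [← hρ, ρ.injective.eq_iff]
  have hminkowski := sqrt_sum_sq_add_le ({τ : Perm V | τ i₀ = x} : Finset (Perm V))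
    (fun τ => Φ (σ * (ρ * τ)) - Φ (ρ * τ)) fun τ => Φ (ρ * τ) - Φ τ
  simpa only [translateDist, sub_add_sub_cancel, hshift, mul_assoc] using hminkowski

/-- The `L²` size of the exchange of the contents of `p` and `q` when the tag is at `x`. -/
noncomputable def exchangeDist (i₀ : V) (Φ : Perm V → ℝ) (x p q : V) : ℝ :=
  translateDist i₀ Φ x (swap p q)

theorem exchangeDist_sq (i₀ : V) (Φ : Perm V → ℝ) (x p q : V) :
    exchangeDist i₀ Φ x p q ^ 2
      = ∑ τ : Perm V with τ i₀ = x, (Φ (swap p q * τ) - Φ τ) ^ 2 := by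
  rw [exchangeDist, translateDist, Real.sq_sqrt (sum_nonneg fun _ _ => sq_nonneg _)]

theorem isQuasiDist_exchangeDist (i₀ : V) (Φ : Perm V → ℝ) (x : V) :
    IsQuasiDist {x}ᶜ (exchangeDist i₀ Φ x) := by
  have hnonneg : ∀ p q, 0 ≤ exchangeDist i₀ Φ x p q := fun _ _ => translateDist_nonneg _ _ _ _
  have hself : ∀ p, exchangeDist i₀ Φ x p p = 0 := fun p => by
    rw [exchangeDist, show (swap p p : Perm V) = 1 from swap_self p]
    simp [translateDist]
  have hsymm : ∀ p q, exchangeDist i₀ Φ x p q = exchangeDist i₀ Φ x q p := fun p q => by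
    rw [exchangeDist, swap_comm, exchangeDist]
  refine ⟨hnonneg, fun p _ q _ => hsymm p q, fun p _ => hself p, fun p hp q hq r hr => ?_⟩
  by_cases hpq : p = q
  · subst hpq
    linarith [hnonneg p r, hself p]
  by_cases hpr : p = r
  · subst hpr
    linarith [hnonneg p q, hnonneg q p, hself p]
  have hfix : ∀ {a b : V}, a ∈ ({x}ᶜ : Set V) → b ∈ ({x}ᶜ : Set V) → swap a b x = x :=
    fun ha hb => swap_apply_of_ne_of_ne (Ne.symm ha) (Ne.symm hb)
  have hconj : swap p r = swap q r * swap p q * swap q r := by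
    rw [swap_mul_swap_mul_swap hpq hpr, swap_comm]
  have houter := translateDist_mul_le i₀ Φ (swap q r * swap p q) (hfix hq hr)
  have hinner := translateDist_mul_le i₀ Φ (swap q r) (hfix hp hq)
  rw [exchangeDist, hconj, exchangeDist, exchangeDist]
  linarith

theorem sum_ite_exchangeDist_sq (i₀ : V) (Φ : Perm V → ℝ) (c : V → V → V → Prop)
    [∀ x p q, Decidable (c x p q)] :
    ∑ x, ∑ p, ∑ q, (if c x p q then exchangeDist i₀ Φ x p q ^ 2 else 0)
      = ∑ τ : Perm V, ∑ p, ∑ q,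
          if c (τ i₀) p q then (Φ (swap p q * τ) - Φ τ) ^ 2 else 0 := by
  have hfibre : ∀ x, ∑ p, ∑ q, (if c x p q then exchangeDist i₀ Φ x p q ^ 2 else 0)
      = ∑ τ : Perm V with τ i₀ = x, ∑ p, ∑ q,
          if c (τ i₀) p q then (Φ (swap p q * τ) - Φ τ) ^ 2 else 0 := fun x => by
    rw [sum_comm (s := {τ : Perm V | τ i₀ = x})]
    refine sum_congr rfl fun p _ => ?_
    rw [sum_comm]
    refine sum_congr rfl fun q _ => ?_
    calc (if c x p q then exchangeDist i₀ Φ x p q ^ 2 else 0)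
        = ∑ τ : Perm V with τ i₀ = x, if c x p q then (Φ (swap p q * τ) - Φ τ) ^ 2 else 0 := by
          rw [exchangeDist_sq]; split_ifs <;> simp
      _ = ∑ τ : Perm V with τ i₀ = x, if c (τ i₀) p q then (Φ (swap p q * τ) - Φ τ) ^ 2 else 0 :=
          sum_congr rfl fun τ hτ => by rw [(mem_filter_univ τ).1 hτ]
  simp only [hfibre]
  exact sum_fiberwise univ (fun τ : Perm V => τ i₀) _

theorem IsTagged.sum_energy_exchangeDist_le {R : V → V → Prop} [DecidableRel R]
    (hR : ∀ p q, R p q → R q p) (hΦ : IsTagged P i₀ Φ) :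
    ∑ x, energy R {x}ᶜ (exchangeDist i₀ Φ x) ≤ 2 * jumpEnergy R P Φ := by
  let jump : Perm V → V → V → ℝ := fun τ u v =>
    if R u v ∧ τ⁻¹ u ∈ P ∧ τ⁻¹ v ∉ P then (Φ (swap u v * τ) - Φ τ) ^ 2 else 0
  have hjump : ∀ τ u v, 0 ≤ jump τ u v := fun τ u v => by
    simp only [jump]; split_ifs <;> positivity
  have hexchange : ∀ τ p q, (if R p q ∧ p ≠ τ i₀ ∧ q ≠ τ i₀ then (Φ (swap p q * τ) - Φ τ) ^ 2
      else 0) ≤ jump τ p q + jump τ q p := fun τ p q => by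
    split_ifs with h
    · by_cases hpq : τ⁻¹ p ∈ P ↔ τ⁻¹ q ∈ P
      · rw [hΦ.swap_mul h.2.1 h.2.2 hpq, sub_self]
        linarith [hjump τ p q, hjump τ q p]
      by_cases hp : τ⁻¹ p ∈ P
      · have hpq' : jump τ p q = (Φ (swap p q * τ) - Φ τ) ^ 2 := if_pos ⟨h.1, hp, by tauto⟩
        linarith [hjump τ q p]
      · have hqp : jump τ q p = (Φ (swap q p * τ) - Φ τ) ^ 2 :=
          if_pos ⟨hR _ _ h.1, by tauto, hp⟩
        rw [swap_comm] at hqp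
        linarith [hjump τ p q]
    · exact add_nonneg (hjump τ p q) (hjump τ q p)
  calc ∑ x, energy R {x}ᶜ (exchangeDist i₀ Φ x)
      = ∑ τ : Perm V, ∑ p, ∑ q,
          if R p q ∧ p ≠ τ i₀ ∧ q ≠ τ i₀ then (Φ (swap p q * τ) - Φ τ) ^ 2 else 0 := by
        simp only [energy_compl]
        exact sum_ite_exchangeDist_sq i₀ Φ fun x p q => R p q ∧ p ≠ x ∧ q ≠ x
    _ ≤ ∑ τ, ∑ p, ∑ q, (jump τ p q + jump τ q p) :=
        sum_le_sum fun τ _ => sum_le_sum fun p _ => sum_le_sum fun q _ => hexchange τ p q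
    _ = 2 * jumpEnergy R P Φ := by
        have hreverse : ∀ τ, ∑ p, ∑ q, jump τ q p = ∑ p, ∑ q, jump τ p q := fun τ => sum_comm
        simp only [sum_add_distrib, hreverse]
        rw [two_mul, jumpEnergy]

theorem sum_swapEnergy_erase_le (i₀ : V) (Φ : Perm V → ℝ) :
    ∑ u ∈ univ.erase i₀, ∑ v ∈ (univ.erase i₀).erase u, swapEnergy Φ u v
      ≤ ∑ x, ∑ p, ∑ q, if p ≠ x ∧ q ≠ x then exchangeDist i₀ Φ x p q ^ 2 else 0 := by
  have hpositions : ∀ τ : Perm V,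
      ∑ p, ∑ q, (if p ≠ τ i₀ ∧ q ≠ τ i₀ then (Φ (swap p q * τ) - Φ τ) ^ 2 else 0)
        = ∑ u, ∑ v, if u ≠ i₀ ∧ v ≠ i₀ then (Φ (τ * swap u v) - Φ τ) ^ 2 else 0 := fun τ => by
    rw [← Equiv.sum_comp τ]
    refine sum_congr rfl fun u _ => ?_
    rw [← Equiv.sum_comp τ]
    simp only [mul_swap_eq_swap_mul, ne_eq, τ.injective.eq_iff]
  calc ∑ u ∈ univ.erase i₀, ∑ v ∈ (univ.erase i₀).erase u, swapEnergy Φ u v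
      ≤ ∑ u ∈ univ.erase i₀, ∑ v ∈ univ.erase i₀, swapEnergy Φ u v :=
        sum_le_sum fun u _ => sum_le_sum_of_subset_of_nonneg (erase_subset _ _)
          fun _ _ _ => swapEnergy_nonneg _ _ _
    _ = ∑ τ : Perm V, ∑ u, ∑ v,
          if u ≠ i₀ ∧ v ≠ i₀ then (Φ (τ * swap u v) - Φ τ) ^ 2 else 0 := by
        symm
        rw [sum_comm, ← filter_ne', sum_filter]
        refine sum_congr rfl fun u _ => ?_
        rw [sum_comm, sum_filter]
        by_cases hu : u = i₀ <;> simp [hu, swapEnergy, sum_ite_irrel]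
    _ = _ := by
        rw [sum_ite_exchangeDist_sq i₀ Φ fun x p q => p ≠ x ∧ q ≠ x]
        exact sum_congr rfl fun τ _ => (hpositions τ).symm

end Tagged

section Cell

variable {V : Type*} [Fintype V] [DecidableEq V] {i₀ j₀ x h : V}

/-- The placements of the labels which put `i₀` at `x` and `j₀` at `h`. -/
def cell (i₀ j₀ x h : V) : Finset (Perm V) := {τ | τ i₀ = x ∧ τ j₀ = h}

theorem mem_cell {τ : Perm V} : τ ∈ cell i₀ j₀ x h ↔ τ i₀ = x ∧ τ j₀ = h := by
  simp [cell]

theorem sum_cell_apply (i₀ j₀ x h : V) (π : Perm V) (F : Perm V → ℝ) :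
    ∑ τ ∈ cell i₀ j₀ (π x) (π h), F τ = ∑ τ ∈ cell i₀ j₀ x h, F (π * τ) :=
  (sum_equiv (Equiv.mulLeft π) (fun τ => by simp [mem_cell]) fun _ _ => rfl).symm

theorem card_cell_apply (i₀ j₀ x h : V) (π : Perm V) :
    (#(cell i₀ j₀ (π x) (π h)) : ℝ) = #(cell i₀ j₀ x h) := by
  simpa using sum_cell_apply i₀ j₀ x h π fun _ => 1

theorem exists_perm_apply_pair {V : Type*} {x h x' h' : V} (hx : x ≠ h) (hx' : x' ≠ h') :
    ∃ π : Perm V, π x = x' ∧ π h = h' := by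
  classical
  refine ⟨swap (swap x x' h) h' * swap x x', ?_, by simp⟩
  rw [Perm.mul_apply, swap_apply_left]
  refine swap_apply_of_ne_of_ne (fun hx'h => hx ?_) hx'
  exact (swap x x').injective (by rw [← hx'h, swap_apply_left])

theorem card_cell_eq (hij : i₀ ≠ j₀) (hx : x ≠ h) :
    (#(cell i₀ j₀ x h) : ℝ) = #(cell i₀ j₀ i₀ j₀) := by
  obtain ⟨π, rfl, rfl⟩ := exists_perm_apply_pair hij hx
  exact card_cell_apply ..

theorem card_cell_pos (i₀ j₀ : V) : (0 : ℝ) < #(cell i₀ j₀ i₀ j₀) := by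
  exact_mod_cast card_pos.2 ⟨1, by simp [mem_cell]⟩

theorem cell_self (hij : i₀ ≠ j₀) (x : V) : cell i₀ j₀ x x = ∅ :=
  eq_empty_of_forall_notMem fun τ hτ =>
    hij (τ.injective ((mem_cell.1 hτ).1.trans (mem_cell.1 hτ).2.symm))

/-- The conditional mean of `Φ` given that `i₀` is at `x` and `j₀` at `h` (`0` if this event is
empty). -/
noncomputable def cellMean (i₀ j₀ : V) (Φ : Perm V → ℝ) (x h : V) : ℝ :=
  (∑ τ ∈ cell i₀ j₀ x h, Φ τ) / #(cell i₀ j₀ x h)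

theorem card_cell_mul_sq_cellMean_sub_le (hij : i₀ ≠ j₀) (hx : x ≠ h) (Φ : Perm V → ℝ)
    (π : Perm V) :
    #(cell i₀ j₀ i₀ j₀) * (cellMean i₀ j₀ Φ (π x) (π h) - cellMean i₀ j₀ Φ x h) ^ 2
      ≤ ∑ τ ∈ cell i₀ j₀ x h, (Φ (π * τ) - Φ τ) ^ 2 := by
  have hincr : cellMean i₀ j₀ Φ (π x) (π h) - cellMean i₀ j₀ Φ x h
      = (∑ τ ∈ cell i₀ j₀ x h, (Φ (π * τ) - Φ τ)) / #(cell i₀ j₀ x h) := by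
    rw [cellMean, cellMean, sum_cell_apply, card_cell_apply, sum_sub_distrib, sub_div]
  rw [← card_cell_eq hij hx, mul_comm, ← le_div_iff₀ (by
    rw [card_cell_eq hij hx]; exact card_cell_pos i₀ j₀), hincr]
  exact sum_div_card_sq_le_sum_sq_div_card

theorem permAvg_eq_cellMean (i₀ j₀ : V) (Φ : Perm V → ℝ) (τ : Perm V) :
    permAvg ((univ.erase i₀).erase j₀) Φ τ = cellMean i₀ j₀ Φ (τ i₀) (τ j₀) := by
  have hmem : ∀ ρ : Perm V, ρ ∈ permsOn ((univ.erase i₀).erase j₀)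
      ↔ τ * ρ ∈ cell i₀ j₀ (τ i₀) (τ j₀) := fun ρ => by
    simp only [mem_permsOn, mem_cell, mem_erase, mem_univ, and_true, not_and_or, not_not,
      Perm.mul_apply, EmbeddingLike.apply_eq_iff_eq]
    exact ⟨fun hρ => ⟨hρ i₀ (Or.inr rfl), hρ j₀ (Or.inl rfl)⟩,
      by rintro ⟨hi, hj⟩ i (rfl | rfl) <;> assumption⟩
  have hsum : ∀ F : Perm V → ℝ, ∑ ρ ∈ permsOn ((univ.erase i₀).erase j₀), F (τ * ρ)
      = ∑ σ ∈ cell i₀ j₀ (τ i₀) (τ j₀), F σ := fun F =>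
    sum_equiv (Equiv.mulLeft τ) hmem fun _ _ => rfl
  have hcard : (#(permsOn ((univ.erase i₀).erase j₀)) : ℝ) = #(cell i₀ j₀ (τ i₀) (τ j₀)) := by
    simpa using hsum fun _ => 1
  rw [permAvg, cellMean, hsum, hcard]

theorem sum_cell_sum (i₀ j₀ : V) (F : V → V → Perm V → ℝ) :
    ∑ x, ∑ h, ∑ τ ∈ cell i₀ j₀ x h, F x h τ = ∑ τ : Perm V, F (τ i₀) (τ j₀) τ := by
  rw [← sum_fiberwise univ fun τ : Perm V => τ i₀]
  refine sum_congr rfl fun x _ => ?_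
  rw [← sum_fiberwise _ fun τ : Perm V => τ j₀]
  refine sum_congr rfl fun h _ => ?_
  rw [filter_filter]
  refine sum_congr rfl fun τ hτ => ?_
  rw [(mem_cell.1 hτ).1, (mem_cell.1 hτ).2]

theorem sum_apply_eq (hij : i₀ ≠ j₀) (g : V → ℝ) :
    ∑ τ : Perm V, g (τ i₀) = #(cell i₀ j₀ i₀ j₀) * (Fintype.card V - 1) * ∑ x, g x := by
  rw [← sum_cell_sum i₀ j₀ fun x _ _ => g x, mul_sum]
  refine sum_congr rfl fun x _ => ?_
  rw [← add_sum_erase _ _ (mem_univ x), cell_self hij, sum_empty, zero_add]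
  calc ∑ h ∈ univ.erase x, ∑ _τ ∈ cell i₀ j₀ x h, g x
      = ∑ _h ∈ univ.erase x, #(cell i₀ j₀ i₀ j₀) * g x := sum_congr rfl fun h hh => by
        rw [sum_const, nsmul_eq_mul, card_cell_eq hij (ne_of_mem_erase hh).symm]
    _ = #(cell i₀ j₀ i₀ j₀) * (Fintype.card V - 1) * g x := by
        rw [sum_const, nsmul_eq_mul, cast_card_erase_of_mem (mem_univ x), card_univ]
        ring

end Cell

section Hole

variable {V : Type*} [Fintype V] [DecidableEq V] {R : V → V → Prop} [DecidableRel R]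
  {i₀ j₀ : V} {P : Finset V} {Φ : Perm V → ℝ}

/-- The sum of the squares of the increments of `Φ` over the exchanges of the content of the
position of `j` with a neighbour. -/
noncomputable def holeEnergy (R : V → V → Prop) [DecidableRel R] (Φ : Perm V → ℝ) (j : V) : ℝ :=
  ∑ τ : Perm V, ∑ v, if R (τ j) v then (Φ (swap (τ j) v * τ) - Φ τ) ^ 2 else 0

theorem holeEnergy_nonneg (Φ : Perm V → ℝ) (j : V) : 0 ≤ holeEnergy R Φ j :=
  sum_nonneg fun _ _ => sum_nonneg fun _ _ => by split_ifs <;> positivity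

theorem holeEnergy_eq_sum_cell (Φ : Perm V → ℝ) (i₀ j₀ : V) :
    holeEnergy R Φ j₀ = ∑ x, ∑ h, ∑ v, if R h v then
      ∑ τ ∈ cell i₀ j₀ x h, (Φ (swap h v * τ) - Φ τ) ^ 2 else 0 := by
  rw [holeEnergy, ← sum_cell_sum i₀ j₀
    fun _ h τ => ∑ v, if R h v then (Φ (swap h v * τ) - Φ τ) ^ 2 else 0]
  refine sum_congr rfl fun x _ => sum_congr rfl fun h _ => ?_
  rw [sum_comm]
  refine sum_congr rfl fun v _ => ?_
  split_ifs <;> simp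

theorem sum_energy_cellMean_le (hij : i₀ ≠ j₀) (Φ : Perm V → ℝ) :
    #(cell i₀ j₀ i₀ j₀) * ∑ x, energy R {x}ᶜ
      (fun h v => |cellMean i₀ j₀ Φ x h - cellMean i₀ j₀ Φ x v|) ≤ holeEnergy R Φ j₀ := by
  simp only [holeEnergy_eq_sum_cell Φ i₀, energy_compl, mul_sum]
  refine sum_le_sum fun x _ => sum_le_sum fun h _ => sum_le_sum fun v _ => ?_
  by_cases hhv : R h v ∧ h ≠ x ∧ v ≠ x
  · have hincr := card_cell_mul_sq_cellMean_sub_le hij hhv.2.1.symm Φ (swap h v)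
    rw [swap_apply_of_ne_of_ne hhv.2.1.symm hhv.2.2.symm, swap_apply_left] at hincr
    rwa [if_pos hhv, if_pos hhv.1, sq_abs, ← neg_sub, neg_sq]
  · rw [if_neg hhv, mul_zero]
    split_ifs <;> positivity

theorem sum_sq_cellMean_swap_le (hR : ∀ p q, R p q → R q p) (hirr : ∀ x, ¬ R x x)
    (hij : i₀ ≠ j₀) (Φ : Perm V → ℝ) :
    #(cell i₀ j₀ i₀ j₀) * ∑ x, ∑ y, (if R x y then
      (cellMean i₀ j₀ Φ x y - cellMean i₀ j₀ Φ y x) ^ 2 else 0) ≤ holeEnergy R Φ j₀ := by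
  simp only [holeEnergy_eq_sum_cell Φ i₀, mul_sum]
  refine sum_le_sum fun x _ => sum_le_sum fun y _ => ?_
  refine le_trans ?_ (single_le_sum (fun v _ => ?_) (mem_univ x))
  · split_ifs with hxy hyx hyx
    · have hx : x ≠ y := fun h => hirr y (h ▸ hxy)
      have hincr := card_cell_mul_sq_cellMean_sub_le hij hx Φ (swap y x)
      rw [swap_apply_left, swap_apply_right] at hincr
      rwa [← neg_sub, neg_sq]
    · exact absurd (hR _ _ hxy) hyx
    · rw [mul_zero]; positivity
    · simp
  · split_ifs <;> positivity

theorem IsTagged.holeEnergy_eq (hΦ : IsTagged P i₀ Φ) (hi₀ : i₀ ∈ P) {j : V} (hj : j ∉ P)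
    (hj₀ : j₀ ∉ P) : holeEnergy R Φ j = holeEnergy R Φ j₀ := by
  have hinv : ∀ τ, Φ (τ * swap j j₀) = Φ τ :=
    hΦ _ (swap_apply_mem_iff (iff_of_false hj hj₀))
      (swap_apply_of_ne_of_ne (ne_of_mem_of_not_mem hi₀ hj) (ne_of_mem_of_not_mem hi₀ hj₀))
  rw [holeEnergy, ← Equiv.sum_comp (Equiv.mulRight (swap j j₀))]
  simp only [Equiv.coe_mulRight, Perm.mul_apply, swap_apply_left, ← mul_assoc, hinv, holeEnergy]

theorem sum_holeEnergy_eq (P : Finset V) (Φ : Perm V → ℝ) :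
    ∑ j ∈ Pᶜ, holeEnergy R Φ j = ∑ τ : Perm V, ∑ v, ∑ h,
      if R h v ∧ τ⁻¹ h ∉ P then (Φ (swap h v * τ) - Φ τ) ^ 2 else 0 := by
  simp only [holeEnergy]
  rw [sum_comm]
  refine sum_congr rfl fun τ _ => ?_
  rw [sum_comm]
  refine sum_congr rfl fun v _ => ?_
  have hcompl : Pᶜ = ({j | j ∉ P} : Finset V) := by ext; simp
  rw [← Equiv.sum_comp τ fun h => if R h v ∧ τ⁻¹ h ∉ P then _ else _, hcompl, sum_filter]
  simp only [Equiv.Perm.inv_def, symm_apply_apply, and_comm (a := R _ v), ite_and]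

theorem IsTagged.card_mul_holeEnergy_le (hR : ∀ p q, R p q → R q p) (hΦ : IsTagged P i₀ Φ)
    (hi₀ : i₀ ∈ P) (hj₀ : j₀ ∉ P) : #Pᶜ * holeEnergy R Φ j₀ ≤ jumpEnergy R P Φ := by
  have hholes : #Pᶜ * holeEnergy R Φ j₀ = ∑ j ∈ Pᶜ, holeEnergy R Φ j := by
    rw [← nsmul_eq_mul, ← sum_const]
    exact sum_congr rfl fun j hj => (hΦ.holeEnergy_eq hi₀ (mem_compl.1 hj) hj₀).symm
  rw [hholes, sum_holeEnergy_eq, jumpEnergy]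
  refine sum_le_sum fun τ _ => sum_le_sum fun v _ => sum_le_sum fun h _ => ?_
  have hne : ∀ {w}, τ⁻¹ w ∉ P → w ≠ τ i₀ := by
    rintro w hw rfl; exact hw (by simpa using hi₀)
  by_cases hhv : R h v ∧ τ⁻¹ h ∉ P
  · rw [if_pos hhv]
    by_cases hv : τ⁻¹ v ∈ P
    · rw [if_pos ⟨hR _ _ hhv.1, hv, hhv.2⟩, swap_comm]
    · rw [hΦ.swap_mul (hne hhv.2) (hne hv) (iff_of_false hhv.2 hv), sub_self,
        zero_pow two_ne_zero]
      split_ifs <;> positivity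
  · rw [if_neg hhv]
    split_ifs <;> positivity

end Hole

section TaggedPoincare

variable {V : Type*} [Fintype V] [DecidableEq V] {R : V → V → Prop} [DecidableRel R]
  {i₀ j₀ : V} {P : Finset V} {Φ : Perm V → ℝ} {n : ℕ} {κ : ℝ}

theorem card_mul_sum_sq_sub_mean_le {V : Type*} [Fintype V] [Nonempty V] (d : V → ℝ) :
    Fintype.card V * ∑ x, (d x - (∑ y, d y) / Fintype.card V) ^ 2
      ≤ ∑ x, ∑ y, (d x - d y) ^ 2 := by
  have hV : (0 : ℝ) < Fintype.card V := by exact_mod_cast Fintype.card_pos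
  rw [mul_sum]
  refine sum_le_sum fun x _ => ?_
  have hmean : d x - (∑ y, d y) / Fintype.card V = (∑ y, (d x - d y)) / #(univ : Finset V) := by
    rw [sum_sub_distrib, sum_const, nsmul_eq_mul, card_univ, sub_div, mul_div_cancel_left₀ _ hV.ne']
  rw [hmean, mul_comm, ← le_div_iff₀ hV]
  exact sum_div_card_sq_le_sum_sq_div_card

theorem sum_sq_le_sum_sq_sub {ι : Type*} [Fintype ι] {f : ι → ℝ} (hf : ∑ i, f i = 0) (c : ℝ) :
    ∑ i, f i ^ 2 ≤ ∑ i, (f i - c) ^ 2 := by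
  have hexpand : ∑ i, (f i - c) ^ 2 = ∑ i, f i ^ 2 + ∑ _i : ι, c ^ 2 - 2 * c * ∑ i, f i := by
    rw [mul_sum, ← sum_add_distrib, ← sum_sub_distrib]
    exact sum_congr rfl fun i _ => by ring
  rw [hexpand, hf]
  have : 0 ≤ ∑ _i : ι, c ^ 2 := by positivity
  linarith

theorem sum_sq_sub_le {ι : Type*} [Fintype ι] (f g k : ι → ℝ) (c : ℝ) :
    ∑ i, (f i - c) ^ 2
      ≤ 2 * ∑ i, (f i - g i) ^ 2 + 4 * ∑ i, (g i - k i) ^ 2 + 4 * ∑ i, (k i - c) ^ 2 := by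
  simp only [mul_sum, ← sum_add_distrib]
  refine sum_le_sum fun i _ => ?_
  have houter := add_sq_le (a := f i - g i) (b := g i - c)
  have hinner := add_sq_le (a := g i - k i) (b := k i - c)
  rw [sub_add_sub_cancel] at houter hinner
  linarith

theorem IsGridLike.four_mul_sq_le_card_sub_one {V : Type*} [Fintype V] {R : V → V → Prop}
    [DecidableRel R] {n : ℕ} {κ : ℝ} (hG : IsGridLike R n κ) :
    4 * (n : ℝ) ^ 2 ≤ Fintype.card V - 1 := by
  have h : ((4 * n ^ 2 + 1 : ℕ) : ℝ) ≤ Fintype.card V := by exact_mod_cast hG.four_mul_sq_lt_card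
  push_cast at h
  linarith

/-- The fluctuation of `Φ` given the position of the tag. -/
theorem IsGridLike.sum_sq_sub_permAvg_le (hG : IsGridLike R n κ) (hΦ : IsTagged P i₀ Φ) :
    ∑ τ, (Φ τ - permAvg (univ.erase i₀) Φ τ) ^ 2
      ≤ κ * (1 + 2 * κ ^ 2) / 2 * n ^ 2 * jumpEnergy R P Φ := by
  have : Nonempty V := ⟨i₀⟩
  have hκ := hG.constant_nonneg
  have hn : (0 : ℝ) < n := by exact_mod_cast hG.one_le
  set W := ∑ τ, (Φ τ - permAvg (univ.erase i₀) Φ τ) ^ 2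
  refine le_of_mul_le_mul_left ?_ (by positivity : 0 < 4 * (n : ℝ) ^ 2)
  calc 4 * (n : ℝ) ^ 2 * W ≤ (Fintype.card V - 1) * W := by
        gcongr; exact hG.four_mul_sq_le_card_sub_one
    _ = #(univ.erase i₀) * W := by rw [cast_card_erase_of_mem (mem_univ i₀), card_univ]
    _ ≤ ∑ x, ∑ p, ∑ q, (if p ≠ x ∧ q ≠ x then exchangeDist i₀ Φ x p q ^ 2 else 0) :=
        (APLG.sum_sq_sub_permAvg_le Φ _).trans (sum_swapEnergy_erase_le i₀ Φ)
    _ ≤ ∑ x, κ * (1 + 2 * κ ^ 2) * n ^ 4 * energy R {x}ᶜ (exchangeDist i₀ Φ x) :=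
        sum_le_sum fun x _ => hG.sum_sq_le_compl (isQuasiDist_exchangeDist i₀ Φ x)
    _ ≤ κ * (1 + 2 * κ ^ 2) * n ^ 4 * (2 * jumpEnergy R P Φ) := by
        rw [← mul_sum]; gcongr; exact hΦ.sum_energy_exchangeDist_le hG.symm
    _ = 4 * n ^ 2 * (κ * (1 + 2 * κ ^ 2) / 2 * n ^ 2 * jumpEnergy R P Φ) := by ring

theorem permAvg_sub_eq_sum_cellMean (hij : i₀ ≠ j₀) (Φ : Perm V → ℝ) (τ : Perm V) (c : ℝ) :
    permAvg (univ.erase i₀) Φ τ - c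
      = (∑ v ∈ univ.erase i₀, (cellMean i₀ j₀ Φ (τ i₀) (τ v) - c)) / #(univ.erase i₀) := by
  have hj₀ : j₀ ∈ univ.erase i₀ := mem_erase.2 ⟨hij.symm, mem_univ _⟩
  have hcard : (#(univ.erase i₀) : ℝ) ≠ 0 := by exact_mod_cast (card_pos.2 ⟨j₀, hj₀⟩).ne'
  have hinsert := permAvg_insert (notMem_erase j₀ (univ.erase i₀)) Φ τ
  rw [insert_erase hj₀] at hinsert
  rw [hinsert, sum_sub_distrib, sum_const, nsmul_eq_mul, sub_div, mul_div_cancel_left₀ _ hcard]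
  congr 2
  refine sum_congr rfl fun v hv => ?_
  rw [permAvg_eq_cellMean, Perm.mul_apply, Perm.mul_apply, swap_apply_left,
    swap_apply_of_ne_of_ne hij (ne_of_mem_erase hv).symm]

/-- The error made by docking the hole `j₀` at the neighbour `k x` of the position `x` of the
tag. -/
theorem IsGridLike.sum_sq_permAvg_sub_docked_le (hG : IsGridLike R n κ) (hij : i₀ ≠ j₀)
    (Φ : Perm V → ℝ) {k : V → V} (hk : ∀ x, R x (k x)) :
    ∑ τ, (permAvg (univ.erase i₀) Φ τ - cellMean i₀ j₀ Φ (τ i₀) (k (τ i₀))) ^ 2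
      ≤ κ * (1 + 2 * κ ^ 2) * n * ((Fintype.card V - 1) * holeEnergy R Φ j₀) := by
  have : Nonempty V := ⟨i₀⟩
  have hκ := hG.constant_nonneg
  set U := cellMean i₀ j₀ Φ
  set E : V → ℝ := fun x => energy R {x}ᶜ fun h v => |U x h - U x v|
  have hcard : (0 : ℝ) ≤ Fintype.card V - 1 :=
    le_trans (by positivity) hG.four_mul_sq_le_card_sub_one
  have hpointwise : ∀ τ : Perm V, (permAvg (univ.erase i₀) Φ τ - U (τ i₀) (k (τ i₀))) ^ 2
      ≤ κ * (1 + 2 * κ ^ 2) * n * E (τ i₀) := fun τ => by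
    have herase : (0 : ℝ) < #(univ.erase i₀) := by
      exact_mod_cast card_pos.2 ⟨j₀, mem_erase.2 ⟨hij.symm, mem_univ _⟩⟩
    rw [permAvg_sub_eq_sum_cellMean hij]
    refine sum_div_card_sq_le_sum_sq_div_card.trans ?_
    rw [div_le_iff₀' herase, ← nsmul_eq_mul]
    refine sum_le_card_nsmul _ _ _ fun v hv => ?_
    simpa only [sq_abs] using hG.sq_le_compl (isQuasiDist_abs_sub {τ i₀}ᶜ (U (τ i₀)))
      (τ.injective.ne (ne_of_mem_erase hv)) (hG.ne (hk _))
  calc ∑ τ, (permAvg (univ.erase i₀) Φ τ - U (τ i₀) (k (τ i₀))) ^ 2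
      ≤ κ * (1 + 2 * κ ^ 2) * n * ∑ τ : Perm V, E (τ i₀) := by
        rw [mul_sum]; exact sum_le_sum fun τ _ => hpointwise τ
    _ = κ * (1 + 2 * κ ^ 2) * n
          * ((Fintype.card V - 1) * (#(cell i₀ j₀ i₀ j₀) * ∑ x, E x)) := by
        rw [sum_apply_eq hij]; ring
    _ ≤ κ * (1 + 2 * κ ^ 2) * n * ((Fintype.card V - 1) * holeEnergy R Φ j₀) := by
        gcongr; exact sum_energy_cellMean_le hij Φ

/-- The fluctuation of the position of the tag, measured with the hole `j₀` docked next to it. -/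
theorem IsGridLike.exists_sum_sq_docked_sub_le (hG : IsGridLike R n κ) (hij : i₀ ≠ j₀)
    (Φ : Perm V → ℝ) {k : V → V} (hk : ∀ x, R x (k x)) :
    ∃ c, ∑ τ : Perm V, (cellMean i₀ j₀ Φ (τ i₀) (k (τ i₀)) - c) ^ 2
      ≤ 3 * κ * (1 + 2 * κ ^ 2) * n ^ 4 * holeEnergy R Φ j₀ := by
  have : Nonempty V := ⟨i₀⟩
  have hκ := hG.constant_nonneg
  set U := cellMean i₀ j₀ Φ
  set N : ℝ := (#(cell i₀ j₀ i₀ j₀) : ℝ)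
  set c := (∑ x, U x (k x)) / Fintype.card V
  have hmoves := sum_energy_cellMean_le (R := R) hij Φ
  have hswaps := sum_sq_cellMean_swap_le (R := R) hG.symm hG.irrefl hij Φ
  refine ⟨c, ?_⟩
  calc ∑ τ : Perm V, (U (τ i₀) (k (τ i₀)) - c) ^ 2
      = N * ((Fintype.card V - 1) * ∑ x, (U x (k x) - c) ^ 2) := by
        rw [sum_apply_eq hij fun x => (U x (k x) - c) ^ 2, mul_assoc]
    _ ≤ N * (Fintype.card V * ∑ x, (U x (k x) - c) ^ 2) := by gcongr; linarith
    _ ≤ N * (κ * n ^ 4 * (6 * κ ^ 2 * ∑ x, energy R {x}ᶜ (fun h v => |U x h - U x v|)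
          + 3 * ∑ x, ∑ y, (if R x y then (U x y - U y x) ^ 2 else 0))) := by
        refine mul_le_mul_of_nonneg_left ?_ (Nat.cast_nonneg _)
        exact (card_mul_sum_sq_sub_mean_le fun x => U x (k x)).trans (hG.sum_sq_docked_le U hk)
    _ = κ * n ^ 4 * (6 * κ ^ 2 * (N * ∑ x, energy R {x}ᶜ (fun h v => |U x h - U x v|))
          + 3 * (N * ∑ x, ∑ y, (if R x y then (U x y - U y x) ^ 2 else 0))) := by ring
    _ ≤ κ * n ^ 4 * (6 * κ ^ 2 * holeEnergy R Φ j₀ + 3 * holeEnergy R Φ j₀) := by gcongr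
    _ = 3 * κ * (1 + 2 * κ ^ 2) * n ^ 4 * holeEnergy R Φ j₀ := by ring

theorem IsTagged.card_univ_mul_holeEnergy_le (hR : ∀ p q, R p q → R q p) (hΦ : IsTagged P i₀ Φ)
    (hi₀ : i₀ ∈ P) (hj₀ : j₀ ∉ P) {β : ℝ} (hβ0 : 0 < β) (hβ : β * Fintype.card V ≤ #Pᶜ) :
    Fintype.card V * holeEnergy R Φ j₀ ≤ jumpEnergy R P Φ / β := by
  rw [le_div_iff₀ hβ0]
  calc Fintype.card V * holeEnergy R Φ j₀ * β = β * Fintype.card V * holeEnergy R Φ j₀ := by ring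
    _ ≤ #Pᶜ * holeEnergy R Φ j₀ := by gcongr; exact holeEnergy_nonneg Φ j₀
    _ ≤ jumpEnergy R P Φ := hΦ.card_mul_holeEnergy_le hR hi₀ hj₀

theorem IsGridLike.exists_sum_sq_sub_le (hG : IsGridLike R n κ) (hΦ : IsTagged P i₀ Φ)
    (hij : i₀ ≠ j₀) :
    ∃ c, ∑ τ, (Φ τ - c) ^ 2 ≤ κ * (1 + 2 * κ ^ 2) * n ^ 2
      * (jumpEnergy R P Φ + 7 * (Fintype.card V * holeEnergy R Φ j₀)) := by
  have : Nonempty V := ⟨i₀⟩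
  have hκ := hG.constant_nonneg
  have hn : (1 : ℝ) ≤ n := by exact_mod_cast hG.one_le
  choose k hk using hG.exists_adj
  obtain ⟨c, hdocked⟩ := hG.exists_sum_sq_docked_sub_le hij Φ hk
  refine ⟨c, ?_⟩
  set h₀ := holeEnergy R Φ j₀
  set J := jumpEnergy R P Φ
  have hh₀ : 0 ≤ h₀ := holeEnergy_nonneg Φ j₀
  have hcard := hG.four_mul_sq_le_card_sub_one
  calc ∑ τ, (Φ τ - c) ^ 2
      ≤ 2 * ∑ τ, (Φ τ - permAvg (univ.erase i₀) Φ τ) ^ 2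
          + 4 * ∑ τ, (permAvg (univ.erase i₀) Φ τ - cellMean i₀ j₀ Φ (τ i₀) (k (τ i₀))) ^ 2
          + 4 * ∑ τ : Perm V, (cellMean i₀ j₀ Φ (τ i₀) (k (τ i₀)) - c) ^ 2 :=
        sum_sq_sub_le _ _ _ c
    _ ≤ 2 * (κ * (1 + 2 * κ ^ 2) / 2 * n ^ 2 * J)
          + 4 * (κ * (1 + 2 * κ ^ 2) * n * ((Fintype.card V - 1) * h₀))
          + 4 * (3 * κ * (1 + 2 * κ ^ 2) * n ^ 4 * h₀) := by
        gcongr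
        exacts [hG.sum_sq_sub_permAvg_le hΦ, hG.sum_sq_permAvg_sub_docked_le hij Φ hk]
    _ = κ * (1 + 2 * κ ^ 2) * (n ^ 2 * J + 4 * (n * ((Fintype.card V - 1) * h₀))
          + 3 * n ^ 2 * (4 * n ^ 2 * h₀)) := by ring
    _ ≤ κ * (1 + 2 * κ ^ 2) * (n ^ 2 * J + 4 * (n ^ 2 * (Fintype.card V * h₀))
          + 3 * n ^ 2 * (Fintype.card V * h₀)) := by
        gcongr
        exacts [by nlinarith, le_self_pow₀ hn two_ne_zero, by linarith, by linarith]
    _ = κ * (1 + 2 * κ ^ 2) * n ^ 2 * (J + 7 * (Fintype.card V * h₀)) := by ring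

theorem IsGridLike.tagged_poincare (hG : IsGridLike R n κ) (hi₀ : i₀ ∈ P) {β : ℝ} (hβ0 : 0 < β)
    (hβ : β * Fintype.card V ≤ #Pᶜ) (hΦ : IsTagged P i₀ Φ) (hmean : ∑ τ, Φ τ = 0) :
    ∑ τ, Φ τ ^ 2 ≤ 8 * κ * (1 + 2 * κ ^ 2) / β * n ^ 2 * jumpEnergy R P Φ := by
  have : Nonempty V := ⟨i₀⟩
  have hκ := hG.constant_nonneg
  have hV : (0 : ℝ) < Fintype.card V := by exact_mod_cast Fintype.card_pos
  obtain ⟨j₀, hj₀⟩ : (Pᶜ).Nonempty :=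
    card_pos.1 (by exact_mod_cast (by positivity : 0 < β * Fintype.card V).trans_le hβ)
  rw [mem_compl] at hj₀
  obtain ⟨c, hc⟩ := hG.exists_sum_sq_sub_le hΦ (ne_of_mem_of_not_mem hi₀ hj₀)
  have hβ1 : β ≤ 1 := by
    refine le_of_mul_le_mul_right (hβ.trans ?_) hV
    rw [one_mul]
    exact_mod_cast card_le_univ Pᶜ
  calc ∑ τ, Φ τ ^ 2 ≤ ∑ τ, (Φ τ - c) ^ 2 := sum_sq_le_sum_sq_sub hmean c
    _ ≤ κ * (1 + 2 * κ ^ 2) * n ^ 2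
          * (jumpEnergy R P Φ + 7 * (Fintype.card V * holeEnergy R Φ j₀)) := hc
    _ ≤ κ * (1 + 2 * κ ^ 2) * n ^ 2 * (jumpEnergy R P Φ / β + 7 * (jumpEnergy R P Φ / β)) := by
        gcongr
        exacts [le_div_self (jumpEnergy_nonneg R P Φ) hβ0 hβ1,
          hΦ.card_univ_mul_holeEnergy_le hG.symm hi₀ hj₀ hβ0 hβ]
    _ = 8 * κ * (1 + 2 * κ ^ 2) / β * n ^ 2 * jumpEnergy R P Φ := by ring

end TaggedPoincare

section Kernels

variable {V : Type*} {P : Finset V} {m : V → V → Perm V → ℝ} {h : Perm V → ℝ}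

/-- `h` depends on the positions of the labels only through the set of the positions of `P`. -/
def IsBlind (P : Finset V) (h : Perm V → ℝ) : Prop :=
  ∀ ρ : Perm V, (∀ i, ρ i ∈ P ↔ i ∈ P) → ∀ τ, h (τ * ρ) = h τ

/-- `m i k τ` is a function of `i`, of the position of `k`, and of the set of the positions of the
labels in `P`; the particle `i` itself contributes `m i i τ`. -/
def IsKernel (P : Finset V) (m : V → V → Perm V → ℝ) : Prop :=
  ∀ ρ : Perm V, (∀ i, ρ i ∈ P ↔ i ∈ P) → ∀ i k τ, m i k (τ * ρ) = m i (ρ k) τ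

/-- The matrices `m i k τ`, `i k ∈ P`, have vanishing row and column sums. -/
structure IsCentred (P : Finset V) (m : V → V → Perm V → ℝ) : Prop where
  row : ∀ i ∈ P, ∀ τ, ∑ k ∈ P, m i k τ = 0
  col : ∀ k ∈ P, ∀ τ, ∑ i ∈ P, m i k τ = 0

/-- The doubly centred part of a kernel. -/
noncomputable def centredPart (P : Finset V) (m : V → V → Perm V → ℝ) (i k : V)
    (τ : Perm V) : ℝ :=
  m i k τ - (∑ j ∈ P, m j k τ) / #P - (∑ l ∈ P, m i l τ) / #P
    + (∑ j ∈ P, ∑ l ∈ P, m j l τ) / #P ^ 2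

/-- The conditional mean, given the occupied sites, of the diagonal sum of a kernel. -/
noncomputable def blindPart (P : Finset V) (m : V → V → Perm V → ℝ) (τ : Perm V) : ℝ :=
  (∑ j ∈ P, ∑ l ∈ P, m j l τ) / #P

theorem IsKernel.sum_row_mul (hm : IsKernel P m) {ρ : Perm V} (hρ : ∀ i, ρ i ∈ P ↔ i ∈ P)
    (i : V) (τ : Perm V) : ∑ k ∈ P, m i k (τ * ρ) = ∑ k ∈ P, m i k τ := by
  simp only [hm ρ hρ]
  exact sum_equiv ρ (fun k => (hρ k).symm) fun _ _ => rfl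

theorem IsKernel.isKernel_centredPart (hm : IsKernel P m) : IsKernel P (centredPart P m) := by
  intro ρ hρ i k τ
  simp only [centredPart, hm.sum_row_mul hρ]
  simp only [hm ρ hρ]

theorem IsKernel.isBlind_blindPart (hm : IsKernel P m) : IsBlind P (blindPart P m) := by
  intro ρ hρ τ
  simp only [blindPart, hm.sum_row_mul hρ]

theorem isCentred_centredPart (P : Finset V) (m : V → V → Perm V → ℝ) :
    IsCentred P (centredPart P m) := by
  have hcard : ∀ {i}, i ∈ P → (#P : ℝ) ≠ 0 := fun hi => by
    exact_mod_cast (card_pos.2 ⟨_, hi⟩).ne'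
  constructor
  · intro i hi τ
    have := hcard hi
    simp only [centredPart, sum_add_distrib, sum_sub_distrib, sum_const, nsmul_eq_mul, ← sum_div]
    rw [sum_comm]
    field_simp
    ring
  · intro k hk τ
    have := hcard hk
    simp only [centredPart, sum_add_distrib, sum_sub_distrib, sum_const, nsmul_eq_mul, ← sum_div]
    field_simp
    ring

theorem blindPart_add_sum_centredPart (P : Finset V) (m : V → V → Perm V → ℝ) (τ : Perm V) :
    blindPart P m τ + ∑ i ∈ P, centredPart P m i i τ = ∑ i ∈ P, m i i τ := by
  rcases P.eq_empty_or_nonempty with rfl | hP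
  · simp [blindPart]
  have hcard : (#P : ℝ) ≠ 0 := by exact_mod_cast hP.card_pos.ne'
  simp only [centredPart, blindPart, sum_add_distrib, sum_sub_distrib, sum_const, nsmul_eq_mul,
    ← sum_div]
  rw [sum_comm (s := P) (t := P) (f := fun i j => m j i τ)]
  field_simp
  ring

theorem IsKernel.increment (hm : IsKernel P m) {c : Perm V → Prop} [DecidablePred c]
    (hc : ∀ ρ : Perm V, (∀ i, ρ i ∈ P ↔ i ∈ P) → ∀ τ, c (τ * ρ) ↔ c τ) (σ : Perm V) :
    IsKernel P fun i k τ => if c τ then m i k (σ * τ) - m i k τ else 0 := by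
  intro ρ hρ i k τ
  simp only [hc ρ hρ, ← mul_assoc, hm ρ hρ]

theorem IsBlind.increment (hh : IsBlind P h) {c : Perm V → Prop} [DecidablePred c]
    (hc : ∀ ρ : Perm V, (∀ i, ρ i ∈ P ↔ i ∈ P) → ∀ τ, c (τ * ρ) ↔ c τ) (σ : Perm V) :
    IsBlind P fun τ => if c τ then h (σ * τ) - h τ else 0 := by
  intro ρ hρ τ
  simp only [hc ρ hρ, ← mul_assoc, hh ρ hρ]

theorem IsCentred.increment (hm : IsCentred P m) (c : Perm V → Prop) [DecidablePred c]
    (σ : Perm V) : IsCentred P fun i k τ => if c τ then m i k (σ * τ) - m i k τ else 0 := by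
  constructor
  · intro i hi τ
    split_ifs
    · rw [sum_sub_distrib, hm.row i hi, hm.row i hi, sub_zero]
    · exact sum_const_zero
  · intro k hk τ
    split_ifs
    · rw [sum_sub_distrib, hm.col k hk, hm.col k hk, sub_zero]
    · exact sum_const_zero

variable [Fintype V]

/-- Exchangeability: `h` is correlated in the same way with all the particles which it does not
distinguish. -/
theorem IsKernel.sum_mul_eq [DecidableEq V] (hm : IsKernel P m) {j k : V} (hj : j ∈ P)
    (hk : k ∈ P) (hh : ∀ τ, h (τ * swap j k) = h τ) :
    ∑ τ, h τ * m j k τ = ∑ τ, h τ * m j j τ := by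
  rw [← Equiv.sum_comp (Equiv.mulRight (swap j k)) fun τ => h τ * m j j τ]
  refine sum_congr rfl fun τ _ => ?_
  rw [Equiv.coe_mulRight, hh, hm _ (swap_apply_mem_iff (iff_of_true hj hk)), swap_apply_left]

variable [DecidableEq V]

theorem IsKernel.sum_blind_mul_eq_zero (hm : IsKernel P m) (hc : IsCentred P m)
    (hh : IsBlind P h) {i : V} (hi : i ∈ P) : ∑ τ, h τ * m i i τ = 0 := by
  have hcard : (#P : ℝ) ≠ 0 := by exact_mod_cast (card_pos.2 ⟨i, hi⟩).ne'
  refine (mul_eq_zero.1 ?_).resolve_left hcard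
  calc (#P : ℝ) * ∑ τ, h τ * m i i τ = ∑ k ∈ P, ∑ τ, h τ * m i k τ := by
        rw [← nsmul_eq_mul, ← sum_const]
        exact sum_congr rfl fun k hk =>
          (hm.sum_mul_eq hi hk (hh _ (swap_apply_mem_iff (iff_of_true hi hk)))).symm
    _ = ∑ τ, h τ * ∑ k ∈ P, m i k τ := by
        rw [sum_comm]; exact sum_congr rfl fun τ _ => (mul_sum ..).symm
    _ = 0 := by simp only [hc.row i hi, mul_zero, sum_const_zero]

theorem IsKernel.card_sub_one_mul_sum_mul_eq (hm : IsKernel P m) (hc : IsCentred P m) {i j : V}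
    (hi : i ∈ P) (hj : j ∈ P) (hij : j ≠ i) :
    ((#P : ℝ) - 1) * ∑ τ, m i i τ * m j j τ = -∑ τ, m i i τ * m j i τ := by
  calc ((#P : ℝ) - 1) * ∑ τ, m i i τ * m j j τ
      = ∑ k ∈ P.erase i, ∑ τ, m i i τ * m j k τ := by
        rw [← cast_card_erase_of_mem hi, ← nsmul_eq_mul, ← sum_const]
        refine sum_congr rfl fun k hk => (hm.sum_mul_eq hj (mem_of_mem_erase hk) fun τ => ?_).symm
        rw [hm _ (swap_apply_mem_iff (iff_of_true hj (mem_of_mem_erase hk))),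
          swap_apply_of_ne_of_ne hij.symm (ne_of_mem_erase hk).symm]
    _ = ∑ τ, m i i τ * ∑ k ∈ P.erase i, m j k τ := by
        rw [sum_comm]; exact sum_congr rfl fun τ _ => (mul_sum ..).symm
    _ = -∑ τ, m i i τ * m j i τ := by
        simp only [sum_erase_eq_sub hi, hc.row j hj, zero_sub, mul_neg, sum_neg_distrib]

theorem IsKernel.card_sub_one_mul_sum_sq (hm : IsKernel P m) (hc : IsCentred P m) :
    ((#P : ℝ) - 1) * ∑ τ, (∑ i ∈ P, m i i τ) ^ 2 = #P * ∑ i ∈ P, ∑ τ, m i i τ ^ 2 := by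
  have hrow : ∀ i ∈ P, ((#P : ℝ) - 1) * ∑ j ∈ P, ∑ τ, m i i τ * m j j τ
      = #P * ∑ τ, m i i τ ^ 2 := fun i hi => by
    calc ((#P : ℝ) - 1) * ∑ j ∈ P, ∑ τ, m i i τ * m j j τ
        = (#P - 1) * ∑ τ, m i i τ * m i i τ
          + ∑ j ∈ P.erase i, -∑ τ, m i i τ * m j i τ := by
          rw [← add_sum_erase _ _ hi, mul_add, mul_sum (s := P.erase i)]
          congr 1
          exact sum_congr rfl fun j hj => hm.card_sub_one_mul_sum_mul_eq hc hi
            (mem_of_mem_erase hj) (ne_of_mem_erase hj)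
      _ = (#P - 1) * ∑ τ, m i i τ * m i i τ - ∑ τ, m i i τ * ∑ j ∈ P.erase i, m j i τ := by
          rw [sum_neg_distrib, sum_comm, ← sub_eq_add_neg]
          simp only [mul_sum]
      _ = #P * ∑ τ, m i i τ ^ 2 := by
          simp only [sum_erase_eq_sub hi, hc.col i hi, zero_sub, mul_neg, sum_neg_distrib,
            ← pow_two]
          ring
  have hsq : ∑ τ, (∑ i ∈ P, m i i τ) ^ 2 = ∑ i ∈ P, ∑ j ∈ P, ∑ τ, m i i τ * m j j τ := by
    simp only [pow_two, sum_mul_sum]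
    rw [sum_comm]
    exact sum_congr rfl fun i _ => sum_comm
  rw [hsq, mul_sum, sum_congr rfl hrow, mul_sum]

theorem IsKernel.sum_sq_bounds (hm : IsKernel P m) (hc : IsCentred P m) :
    ∑ i ∈ P, ∑ τ, m i i τ ^ 2 ≤ ∑ τ, (∑ i ∈ P, m i i τ) ^ 2 ∧
      ∑ τ, (∑ i ∈ P, m i i τ) ^ 2 ≤ 2 * ∑ i ∈ P, ∑ τ, m i i τ ^ 2 := by
  have hdiag : 0 ≤ ∑ i ∈ P, ∑ τ, m i i τ ^ 2 := by positivity
  have htotal : 0 ≤ ∑ τ, (∑ i ∈ P, m i i τ) ^ 2 := by positivity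
  have hcorr := hm.card_sub_one_mul_sum_sq hc
  rcases lt_or_ge #P 2 with hcard | hcard
  · interval_cases hP : #P
    · rw [card_eq_zero] at hP
      simp [hP]
    · obtain ⟨i, rfl⟩ := card_eq_one.1 hP
      simp only [sum_singleton] at hdiag ⊢
      constructor <;> linarith
  · have hcard' : (2 : ℝ) ≤ #P := by exact_mod_cast hcard
    constructor <;> nlinarith

theorem IsKernel.sum_sq_add_bounds (hm : IsKernel P m) (hc : IsCentred P m) (hh : IsBlind P h) :
    ∑ τ, h τ ^ 2 + ∑ i ∈ P, ∑ τ, m i i τ ^ 2 ≤ ∑ τ, (h τ + ∑ i ∈ P, m i i τ) ^ 2 ∧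
      ∑ τ, (h τ + ∑ i ∈ P, m i i τ) ^ 2 ≤ ∑ τ, h τ ^ 2 + 2 * ∑ i ∈ P, ∑ τ, m i i τ ^ 2 := by
  have horth : ∑ τ, h τ * ∑ i ∈ P, m i i τ = 0 := by
    simp only [mul_sum]
    rw [sum_comm]
    exact sum_eq_zero fun i hi => hm.sum_blind_mul_eq_zero hc hh hi
  have hpythagoras : ∑ τ, (h τ + ∑ i ∈ P, m i i τ) ^ 2
      = ∑ τ, h τ ^ 2 + ∑ τ, (∑ i ∈ P, m i i τ) ^ 2 := by
    simp only [add_sq, sum_add_distrib, mul_assoc, ← mul_sum (s := (univ : Finset (Perm V))),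
      horth, mul_zero, add_zero]
  obtain ⟨hlower, hupper⟩ := hm.sum_sq_bounds hc
  rw [hpythagoras]
  constructor <;> linarith

variable {R : V → V → Prop} [DecidableRel R]

theorem jumpEnergy_eq_sum_sq (P : Finset V) (Φ : Perm V → ℝ) :
    jumpEnergy R P Φ = ∑ u, ∑ v, ∑ τ : Perm V,
      (if R u v ∧ τ⁻¹ u ∈ P ∧ τ⁻¹ v ∉ P then Φ (swap u v * τ) - Φ τ else 0) ^ 2 := by
  rw [jumpEnergy, sum_comm]
  refine sum_congr rfl fun u _ => ?_
  rw [sum_comm]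
  refine sum_congr rfl fun v _ => sum_congr rfl fun τ _ => ?_
  split_ifs <;> simp

theorem IsKernel.jumpEnergy_add_le (hm : IsKernel P m) (hc : IsCentred P m) (hh : IsBlind P h) :
    jumpEnergy R P h + ∑ i ∈ P, jumpEnergy R P (fun τ => m i i τ)
      ≤ jumpEnergy R P fun τ => h τ + ∑ i ∈ P, m i i τ := by
  simp only [jumpEnergy_eq_sum_sq]
  rw [sum_comm (s := P), ← sum_add_distrib]
  refine sum_le_sum fun u _ => ?_
  rw [sum_comm (s := P), ← sum_add_distrib]
  refine sum_le_sum fun v _ => ?_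
  have hinv : ∀ ρ : Perm V, (∀ i, ρ i ∈ P ↔ i ∈ P) → ∀ τ : Perm V,
      (R u v ∧ (τ * ρ)⁻¹ u ∈ P ∧ (τ * ρ)⁻¹ v ∉ P) ↔ R u v ∧ τ⁻¹ u ∈ P ∧ τ⁻¹ v ∉ P :=
    fun ρ hρ τ => by
      have hpos : ∀ w, (τ * ρ)⁻¹ w ∈ P ↔ τ⁻¹ w ∈ P := fun w => by
        rw [← hρ ((τ * ρ)⁻¹ w), mul_inv_rev, Perm.mul_apply, Perm.inv_def ρ,
          apply_symm_apply]
      rw [hpos, hpos]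
  -- the increments over one jump are again a blind function and a centred kernel
  refine ((hm.increment hinv (swap u v)).sum_sq_add_bounds (hc.increment _ _)
    (hh.increment hinv (swap u v))).1.trans (le_of_eq (sum_congr rfl fun τ _ => ?_))
  split_ifs
  · rw [sum_sub_distrib, add_sub_add_comm]
  · rw [sum_const_zero, add_zero]

theorem IsGridLike.kernel_poincare {n : ℕ} {κ β : ℝ} (hG : IsGridLike R n κ) (hβ0 : 0 < β)
    (hβ : β * Fintype.card V ≤ #Pᶜ) (hm : IsKernel P m) (hmean : ∑ τ, ∑ i ∈ P, m i i τ = 0) :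
    ∑ τ, (∑ i ∈ P, m i i τ) ^ 2
      ≤ 16 * κ * (1 + 2 * κ ^ 2) / β * n ^ 2 * jumpEnergy R P fun τ => ∑ i ∈ P, m i i τ := by
  rcases P.eq_empty_or_nonempty with rfl | ⟨i₀, hi₀⟩
  · simp [jumpEnergy]
  have : Nonempty V := ⟨i₀⟩
  have hκ := hG.constant_nonneg
  have hcentred := isCentred_centredPart P m
  have hkernel := hm.isKernel_centredPart
  have hblind := hm.isBlind_blindPart
  have hdecomp : (fun τ => ∑ i ∈ P, m i i τ)
      = fun τ => blindPart P m τ + ∑ i ∈ P, centredPart P m i i τ :=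
    funext fun τ => (blindPart_add_sum_centredPart P m τ).symm
  have hcentred_mean : ∀ i ∈ P, ∑ τ, centredPart P m i i τ = 0 := fun i hi => by
    simpa using hkernel.sum_blind_mul_eq_zero hcentred (h := fun _ => 1) (fun _ _ _ => rfl) hi
  have hblind_mean : ∑ τ, blindPart P m τ = 0 := by
    rwa [hdecomp, sum_add_distrib, sum_comm, sum_eq_zero hcentred_mean, add_zero] at hmean
  set C := 8 * κ * (1 + 2 * κ ^ 2) / β * (n : ℝ) ^ 2 with hC
  calc ∑ τ, (∑ i ∈ P, m i i τ) ^ 2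
      ≤ ∑ τ, blindPart P m τ ^ 2 + 2 * ∑ i ∈ P, ∑ τ, centredPart P m i i τ ^ 2 := by
        simp only [← blindPart_add_sum_centredPart P m]
        exact (hkernel.sum_sq_add_bounds hcentred hblind).2
    _ ≤ C * jumpEnergy R P (blindPart P m)
          + 2 * ∑ i ∈ P, C * jumpEnergy R P fun τ => centredPart P m i i τ := by
        gcongr with i hi
        · exact hG.tagged_poincare hi₀ hβ0 hβ (fun ρ hρ _ => hblind ρ hρ) hblind_mean
        · exact hG.tagged_poincare hi hβ0 hβ (fun ρ hρ hρi τ => by rw [hkernel ρ hρ, hρi])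
            (hcentred_mean i hi)
    _ ≤ 2 * C * (jumpEnergy R P (blindPart P m)
          + ∑ i ∈ P, jumpEnergy R P fun τ => centredPart P m i i τ) := by
        have hblind_energy : 0 ≤ C * jumpEnergy R P (blindPart P m) :=
          mul_nonneg (by positivity) (jumpEnergy_nonneg R P _)
        rw [← mul_sum]
        linarith
    _ ≤ 2 * C * jumpEnergy R P fun τ => ∑ i ∈ P, m i i τ := by
        rw [hdecomp]
        gcongr
        exact hkernel.jumpEnergy_add_le hcentred hblind
    _ = 16 * κ * (1 + 2 * κ ^ 2) / β * n ^ 2 * jumpEnergy R P fun τ => ∑ i ∈ P, m i i τ := by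
        rw [hC]; ring

end Kernels

section Reversibility

variable {V : Type*} [Fintype V] [DecidableEq V] {R : V → V → Prop} [DecidableRel R]

/-- The sum of `ψ τ σ` over the jumps of a particle (a label in `P`) to a neighbouring hole, where
`τ` and `σ` are the positions of the labels before and after the jump. -/
noncomputable def jumpSum (R : V → V → Prop) [DecidableRel R] (P : Finset V)
    (ψ : Perm V → Perm V → ℝ) : ℝ :=
  ∑ τ : Perm V, ∑ u : V, ∑ v : V,
    if R u v ∧ τ⁻¹ u ∈ P ∧ τ⁻¹ v ∉ P then ψ τ (swap u v * τ) else 0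

theorem jumpSum_add (R : V → V → Prop) [DecidableRel R] (P : Finset V)
    (ψ ψ' : Perm V → Perm V → ℝ) :
    jumpSum R P (fun τ σ => ψ τ σ + ψ' τ σ) = jumpSum R P ψ + jumpSum R P ψ' := by
  simp only [jumpSum, ← sum_add_distrib, ite_add_zero]

theorem jumpSum_reverse (hR : ∀ u v, R u v → R v u) (P : Finset V) (ψ : Perm V → Perm V → ℝ) :
    jumpSum R P (fun τ σ => ψ σ τ) = jumpSum R P ψ := by
  have hjumps : ∀ ψ : Perm V → Perm V → ℝ, jumpSum R P ψ = ∑ u, ∑ v, ∑ τ : Perm V,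
      if R u v ∧ τ⁻¹ u ∈ P ∧ τ⁻¹ v ∉ P then ψ τ (swap u v * τ) else 0 := fun ψ => by
    rw [jumpSum, sum_comm]
    exact sum_congr rfl fun u _ => sum_comm
  rw [hjumps, hjumps, sum_comm]
  refine sum_congr rfl fun v _ => sum_congr rfl fun u _ => ?_
  refine sum_equiv (Equiv.mulLeft (swap u v)) (by simp) fun τ _ => ?_
  simp only [Equiv.coe_mulLeft, mul_inv_rev, swap_inv, Perm.mul_apply, swap_apply_left,
    swap_apply_right, swap_comm v u, swap_mul_self_mul, (⟨hR u v, hR v u⟩ : R u v ↔ R v u)]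

theorem sum_mul_neg_generator_eq (hR : ∀ u v, R u v → R v u) (P : Finset V) (Φ : Perm V → ℝ) :
    ∑ τ : Perm V, Φ τ * -(∑ u, ∑ v, if R u v ∧ τ⁻¹ u ∈ P ∧ τ⁻¹ v ∉ P then
      Φ (swap u v * τ) - Φ τ else 0) = jumpEnergy R P Φ / 2 := by
  have henergy : jumpEnergy R P Φ = 2 * jumpSum R P fun τ σ => Φ τ * (Φ τ - Φ σ) := by
    calc jumpEnergy R P Φ
        = jumpSum R P fun τ σ => Φ τ * (Φ τ - Φ σ) + Φ σ * (Φ σ - Φ τ) :=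
          show jumpSum R P (fun τ σ => (Φ σ - Φ τ) ^ 2) = _ from
            congrArg (jumpSum R P) (funext₂ fun τ σ => by ring)
      _ = 2 * jumpSum R P fun τ σ => Φ τ * (Φ τ - Φ σ) := by
          rw [jumpSum_add, jumpSum_reverse hR P fun τ σ => Φ τ * (Φ τ - Φ σ), two_mul]
  rw [henergy, mul_div_cancel_left₀ _ two_ne_zero, jumpSum]
  refine sum_congr rfl fun τ _ => ?_
  simp only [← sum_neg_distrib, mul_sum]
  refine sum_congr rfl fun u _ => sum_congr rfl fun v _ => ?_
  split_ifs <;> ring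

end Reversibility

section Occupation

/-- Whether a site is occupied. -/
def Site.isOcc : Site → Bool
  | empty => false
  | _ => true

theorem Site.eta_eq (s : Site) : s.eta = if s.isOcc then 1 else 0 := by
  cases s <;> simp [Site.eta, Site.etaA, Site.etaP, Site.isOcc]

theorem Site.isOcc_eq_false_iff {s : Site} : s.isOcc = false ↔ s = Site.empty := by
  cases s <;> simp [Site.isOcc]

theorem Site.card_angles (s : Site) :
    s.activeAngles.card + s.passiveAngles.card = if s.isOcc then 1 else 0 := by
  cases s <;> simp [Site.activeAngles, Site.passiveAngles, Site.isOcc]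

variable {ι : Type} [Fintype ι]

/-- The set of the occupied sites of a configuration. -/
def occ (η : Config ι) : Finset ι := {x | (η x).isOcc}

theorem mem_occ {η : Config ι} {x : ι} : x ∈ occ η ↔ (η x).isOcc := by simp [occ]

theorem card_occ (η : Config ι) :
    #(occ η) = (∑ x, (η x).activeAngles).card + (∑ x, (η x).passiveAngles).card := by
  rw [Multiset.card_sum, Multiset.card_sum, ← sum_add_distrib, occ, card_filter]
  exact sum_congr rfl fun x _ => (Site.card_angles _).symm

open Classical in
theorem card_eq_active (η : Config ι) (θ : Real.Angle) :
    #{x | η x = Site.active θ} = (∑ x, (η x).activeAngles).count θ := by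
  rw [Multiset.count_sum', card_filter]
  refine sum_congr rfl fun x _ => ?_
  cases η x <;> simp [Site.activeAngles, Multiset.count_singleton, eq_comm]

open Classical in
theorem card_eq_passive (η : Config ι) (θ : Real.Angle) :
    #{x | η x = Site.passive θ} = (∑ x, (η x).passiveAngles).count θ := by
  rw [Multiset.count_sum', card_filter]
  refine sum_congr rfl fun x _ => ?_
  cases η x <;> simp [Site.passiveAngles, Multiset.count_singleton, eq_comm]

open Classical in
theorem card_eq_empty (η : Config ι) :
    #{x | η x = Site.empty} = Fintype.card ι - #(occ η) := by
  rw [← card_compl]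
  congr 1
  ext x
  simp [mem_occ, Site.isOcc_eq_false_iff]

theorem exists_perm_eq_comp {ι α : Type*} [Fintype ι] [DecidableEq α] {η ξ : ι → α}
    (h : ∀ a, #{x | η x = a} = #{x | ξ x = a}) : ∃ σ : Perm ι, η = ξ ∘ σ := by
  have hfibre : ∀ a, Nonempty ({x // η x = a} ≃ {x // ξ x = a}) := fun a => by
    rw [← Fintype.card_eq, Fintype.card_subtype, Fintype.card_subtype, h a]
  let e : ∀ a, {x // η x = a} ≃ {x // ξ x = a} := fun a => (hfibre a).some
  exact ⟨(sigmaFiberEquiv η).symm.trans ((sigmaCongrRight e).trans (sigmaFiberEquiv ξ)),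
    funext fun x => (e (η x) ⟨x, rfl⟩).2.symm⟩

theorem exists_perm_eq_comp_of_sum_angles {η ξ : Config ι}
    (hactive : ∑ x, (η x).activeAngles = ∑ x, (ξ x).activeAngles)
    (hpassive : ∑ x, (η x).passiveAngles = ∑ x, (ξ x).passiveAngles) :
    ∃ σ : Perm ι, η = ξ ∘ σ := by
  classical
  refine exists_perm_eq_comp fun s => ?_
  cases s with
  | empty => rw [card_eq_empty, card_eq_empty, card_occ, card_occ, hactive, hpassive]
  | active θ => rw [card_eq_active, card_eq_active, hactive]
  | passive θ => rw [card_eq_passive, card_eq_passive, hpassive]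

end Occupation

section CanonicalMeasure

theorem sum_div_card_eq_of_coe_eq_orbit {G X : Type*} [Group G] [Fintype G] [MulAction G X]
    {H : Finset X} {ξ : X} (hH : (H : Set X) = MulAction.orbit G ξ) (g : X → ℝ) :
    (∑ η ∈ H, g η) / #H = (∑ τ : G, g (τ • ξ)) / Fintype.card G := by
  classical
  set c := #{τ : G | τ • ξ = ξ}
  have hc : (c : ℝ) ≠ 0 :=
    Nat.cast_ne_zero.2 (card_ne_zero_of_mem (mem_filter_univ 1 |>.2 (one_smul G ξ)))
  have hfibre : ∀ η ∈ H, #{τ : G | τ • ξ = η} = c := fun η hη => by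
    obtain ⟨σ, rfl⟩ : η ∈ MulAction.orbit G ξ := hH ▸ mem_coe.2 hη
    refine (card_equiv (Equiv.mulLeft σ) fun τ => ?_).symm
    simp [mul_smul]
  have hsum : ∀ g : X → ℝ, ∑ τ : G, g (τ • ξ) = c * ∑ η ∈ H, g η := fun g => by
    rw [← sum_fiberwise_of_maps_to (t := H) (g := fun τ : G => τ • ξ)
      fun τ _ => mem_coe.1 (hH ▸ MulAction.mem_orbit ξ τ), mul_sum]
    refine sum_congr rfl fun η hη => ?_
    rw [sum_congr rfl fun τ hτ => congrArg g (mem_filter.1 hτ).2, sum_const, hfibre η hη,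
      nsmul_eq_mul]
  have hcard : (Fintype.card G : ℝ) = c * #H := by simpa using hsum fun _ => 1
  rw [hsum, hcard, mul_div_mul_left _ _ hc]

variable {n : ℕ} (K : CanonicalState n) {ξ : Config (box n)}

theorem CanonicalState.mem_hyperplane_iff_exists_perm (hξ : ξ ∈ K.hyperplane)
    {η : Config (box n)} : η ∈ K.hyperplane ↔ ∃ τ : Perm (box n), ξ ∘ ⇑τ⁻¹ = η := by
  constructor
  · intro hη
    obtain ⟨σ, rfl⟩ := exists_perm_eq_comp_of_sum_angles (hη.1.trans hξ.1.symm)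
      (hη.2.trans hξ.2.symm)
    exact ⟨σ⁻¹, by rw [inv_inv]⟩
  · rintro ⟨τ, rfl⟩
    exact ⟨(Equiv.sum_comp τ⁻¹ fun x => (ξ x).activeAngles).trans hξ.1,
      (Equiv.sum_comp τ⁻¹ fun x => (ξ x).passiveAngles).trans hξ.2⟩

theorem CanonicalState.expect_eq (hξ : ξ ∈ K.hyperplane) (g : Config (box n) → ℝ) :
    K.expect g = (∑ τ : Perm (box n), g (ξ ∘ ⇑τ⁻¹)) / Fintype.card (Perm (box n)) := by
  let _ : MulAction (Perm (box n)) (Config (box n)) := arrowAction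
  refine sum_div_card_eq_of_coe_eq_orbit ?_ g
  rw [Set.Finite.coe_toFinset]
  exact Set.ext fun η => K.mem_hyperplane_iff_exists_perm hξ

theorem generator_comp_inv (g : Config (box n) → ℝ) (ξ : Config (box n)) (τ : Perm (box n)) :
    generator n g (ξ ∘ ⇑τ⁻¹) = ∑ x, ∑ y,
      if boxAdj n x y ∧ τ⁻¹ x ∈ occ ξ ∧ τ⁻¹ y ∉ occ ξ then
        g (ξ ∘ ⇑(swap x y * τ)⁻¹) - g (ξ ∘ ⇑τ⁻¹) else 0 := by
  refine sum_congr rfl fun x _ => sum_congr rfl fun y _ => ?_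
  have hswap : (ξ ∘ ⇑τ⁻¹) ∘ ⇑(swap x y) = ξ ∘ ⇑(swap x y * τ)⁻¹ := by
    rw [mul_inv_rev, swap_inv, Perm.coe_mul, Function.comp_assoc]
  simp only [hswap, Site.eta_eq, mem_occ, Function.comp_apply, boxAdj]
  split_ifs <;> simp_all

theorem dirichletForm_eq (hξ : ξ ∈ K.hyperplane) (g : Config (box n) → ℝ) :
    dirichletForm K g = jumpEnergy (boxAdj n) (occ ξ) (fun τ => g (ξ ∘ ⇑τ⁻¹)) / 2
      / Fintype.card (Perm (box n)) := by
  rw [dirichletForm, K.expect_eq hξ, ← sum_mul_neg_generator_eq fun _ _ h => h.symm]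
  simp only [generator_comp_inv]

theorem CanonicalState.card_compl_occ_ge {α' : ℝ} (hα : K.alphaA + K.alphaP ≤ α')
    (hξ : ξ ∈ K.hyperplane) : (1 - α') * Fintype.card (box n) ≤ #(occ ξ)ᶜ := by
  have hbox : (0 : ℝ) < #(box n) := by rw [card_box]; positivity
  have hocc : (#(occ ξ) : ℝ) ≤ α' * #(box n) := by
    rw [CanonicalState.alphaA, CanonicalState.alphaP, ← add_div, div_le_iff₀ hbox] at hα
    rwa [card_occ, hξ.1, hξ.2, Nat.cast_add]
  rw [card_compl, Nat.cast_sub (card_le_univ _), Fintype.card_coe]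
  linarith

end CanonicalMeasure

section ParticleSums

variable {ι : Type} [Fintype ι]

/-- The functions on the configurations which are sums over the particles of functions of the
state and the position of the particle and of the set of all occupied sites. -/
def IsParticleSum (F : Config ι → ℝ) : Prop :=
  ∃ g : Site → ι → Finset ι → ℝ, ∀ η, F η = ∑ x ∈ occ η, g (η x) x (occ η)

theorem apply_update_eq_of_mem_blindFunctions {F : ConfigZ2 → ℝ} (hF : F ∈ blindFunctions)
    (η : ConfigZ2) {x : ℤ × ℤ} {s : Site} (hs : s.isOcc = (η x).isOcc) :
    F (Function.update η x s) = F η := by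
  cases hocc : (η x).isOcc with
  | false =>
    rw [Site.isOcc_eq_false_iff.1 (hs.trans hocc), ← Site.isOcc_eq_false_iff.1 hocc,
      Function.update_eq_self]
  | true =>
    obtain ⟨f, g, hf, hFfg⟩ := hF x
    have hoff : f (Function.update η x s) = f η := hf fun y hy => Function.update_of_ne hy _ _
    simp [hFfg, Site.eta_eq, hs, hocc, hoff]

theorem eq_of_mem_blindFunctions {F : ConfigZ2 → ℝ} (hF : F ∈ blindFunctions)
    {s : Finset (ℤ × ℤ)} {η η' : ConfigZ2} (hocc : ∀ x, (η' x).isOcc = (η x).isOcc)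
    (hs : ∀ x ∉ s, η' x = η x) : F η' = F η := by
  have hpiecewise : ∀ t : Finset (ℤ × ℤ), F (t.piecewise η' η) = F η := fun t => by
    induction t using Finset.induction_on with
    | empty => rw [piecewise_empty]
    | insert x t hx ih =>
      rw [piecewise_insert, apply_update_eq_of_mem_blindFunctions hF _ ?_, ih]
      rw [piecewise_eq_of_notMem _ _ _ hx, hocc]
  rw [← hpiecewise s]
  congr 1
  ext1 x
  by_cases hx : x ∈ s
  · rw [piecewise_eq_of_mem _ _ _ hx]
  · rw [piecewise_eq_of_notMem _ _ _ hx, hs x hx]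

/-- The extension of a configuration on the box by empty sites. -/
noncomputable def extend {n : ℕ} (η : Config (box n)) : ConfigZ2 :=
  fun x => if h : x ∈ box n then η ⟨x, h⟩ else Site.empty

theorem extend_coe {n : ℕ} (η : Config (box n)) (x : box n) : extend η x = η x := by
  simp [extend]

theorem extend_of_notMem {n : ℕ} (η : Config (box n)) {x : ℤ × ℤ} (hx : x ∉ box n) :
    extend η x = Site.empty := dif_neg hx

/-- The configuration with an active particle of angle `0` at each site of `A`, by which a blind
function is turned into a function of the set of the occupied sites. -/
noncomputable def indicatorConfig {n : ℕ} (A : Finset (box n)) : Config (box n) :=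
  fun x => if x ∈ A then Site.active 0 else Site.empty

theorem isOcc_indicatorConfig_occ {n : ℕ} (η : Config (box n)) (x : box n) :
    (indicatorConfig (occ η) x).isOcc = (η x).isOcc := by
  simp only [indicatorConfig, mem_occ]
  cases (η x).isOcc <;> rfl

theorem apply_extend_eq {n : ℕ} {F : ConfigZ2 → ℝ} (hF : F ∈ blindFunctions)
    (η : Config (box n)) : F (extend η) = F (extend (indicatorConfig (occ η))) := by
  refine eq_of_mem_blindFunctions hF (s := box n) (fun x => ?_) fun x hx => by
    rw [extend_of_notMem _ hx, extend_of_notMem _ hx]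
  by_cases hx : x ∈ box n
  · lift x to box n using hx
    rw [extend_coe, extend_coe, isOcc_indicatorConfig_occ]
  · rw [extend_of_notMem _ hx, extend_of_notMem _ hx]

theorem isParticleSum_of_hasSum {n : ℕ} {h : Site → ℝ} (hempty : h Site.empty = 0)
    {F : ℤ × ℤ → ConfigZ2 → ℝ} (hF : ∀ x, F x ∈ blindFunctions) {f : ConfigZ2 → ℝ}
    (hf : ∀ η, HasSum (fun x => h (η x) * F x η) (f η)) : IsParticleSum (onBox n f) := by
  refine ⟨fun s x A => h s * F x (extend (indicatorConfig A)), fun η => ?_⟩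
  have hsupport : ∀ x ∉ (occ η).map (Function.Embedding.subtype (· ∈ box n)),
      h (extend η x) * F x (extend η) = 0 := fun x hx => by
    suffices extend η x = Site.empty by rw [this, hempty, zero_mul]
    by_cases hbox : x ∈ box n
    · lift x to box n using hbox
      rw [extend_coe, ← Site.isOcc_eq_false_iff]
      simpa [mem_occ] using hx
    · exact extend_of_notMem _ hbox
  have hsum := (hf (extend η)).unique (hasSum_sum_of_ne_finset_zero hsupport)
  rw [sum_map] at hsum
  refine hsum.trans (sum_congr rfl fun x _ => ?_)
  rw [Function.Embedding.subtype_apply, extend_coe, apply_extend_eq (hF x) η]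

theorem isParticleSum_onBox {ω : Real.Angle → ℝ} {f : ConfigZ2 → ℝ} (hf : f ∈ classT ω) (n : ℕ) :
    IsParticleSum (onBox n f) := by
  induction hf using Submodule.span_induction with
  | mem f hf =>
    obtain ⟨_, a, b, c, d, F, hF, hsum⟩ := hf
    refine isParticleSum_of_hasSum (h := fun s => a * s.etaA + b * s.etaP
      + c * (ω s.angle * s.etaA) + d * (ω s.angle * s.etaP)) ?_ hF hsum
    simp [Site.etaA, Site.etaP]
  | zero => exact ⟨fun _ _ _ => 0, fun η => by simp [onBox]⟩
  | add f₁ f₂ _ _ hf₁ hf₂ =>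
    obtain ⟨g₁, hg₁⟩ := hf₁
    obtain ⟨g₂, hg₂⟩ := hf₂
    refine ⟨fun s x A => g₁ s x A + g₂ s x A, fun η => ?_⟩
    rw [sum_add_distrib, ← hg₁, ← hg₂]
    rfl
  | smul r f _ hf =>
    obtain ⟨g, hg⟩ := hf
    refine ⟨fun s x A => r * g s x A, fun η => ?_⟩
    rw [← mul_sum, ← hg]
    rfl

theorem isKernel_particle (g : Site → ι → Finset ι → ℝ) (ξ : Config ι) :
    IsKernel (occ ξ) fun i k τ => g (ξ i) (τ k) (occ (ξ ∘ ⇑τ⁻¹)) := by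
  intro ρ hρ i k τ
  have hocc : occ (ξ ∘ ⇑(τ * ρ)⁻¹) = occ (ξ ∘ ⇑τ⁻¹) := by
    ext x
    have hlabel : ξ (ρ ((τ * ρ)⁻¹ x)) = ξ (τ⁻¹ x) := by simp
    have hx := hρ ((τ * ρ)⁻¹ x)
    rw [mem_occ, mem_occ, hlabel] at hx
    simpa only [mem_occ, Function.comp_apply] using hx.symm
  simp only [hocc, Perm.mul_apply]

theorem IsParticleSum.exists_isKernel {F : Config ι → ℝ} (hF : IsParticleSum F)
    (ξ : Config ι) : ∃ m : ι → ι → Perm ι → ℝ, IsKernel (occ ξ) m ∧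
      ∀ τ : Perm ι, F (ξ ∘ ⇑τ⁻¹) = ∑ i ∈ occ ξ, m i i τ := by
  obtain ⟨g, hg⟩ := hF
  refine ⟨_, isKernel_particle g ξ, fun τ => ?_⟩
  rw [hg]
  exact (sum_equiv τ (fun i => by simp [mem_occ]) fun i _ => by simp).symm

theorem IsParticleSum.sum_sq_le {n : ℕ} {F : Config (box n) → ℝ} (hF : IsParticleSum F)
    {ξ : Config (box n)} {β : ℝ} (hβ0 : 0 < β) (hβ : β * Fintype.card (box n) ≤ #(occ ξ)ᶜ)
    (hmean : ∑ τ : Perm (box n), F (ξ ∘ ⇑τ⁻¹) = 0) :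
    ∑ τ : Perm (box n), F (ξ ∘ ⇑τ⁻¹) ^ 2
      ≤ 16 * 3456 * (1 + 2 * 3456 ^ 2) / β * n ^ 2
        * jumpEnergy (boxAdj n) (occ ξ) fun τ => F (ξ ∘ ⇑τ⁻¹) := by
  rcases n.eq_zero_or_pos with rfl | hn
  · have hsite : Subsingleton (box 0) :=
      Fintype.card_le_one_iff_subsingleton.1 (by simp [card_box])
    rw [Fintype.sum_subsingleton _ 1] at hmean ⊢
    rw [hmean]
    simp
  · obtain ⟨m, hm, hFm⟩ := hF.exists_isKernel ξ
    simp only [hFm] at hmean ⊢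
    exact (isGridLike_boxAdj hn).kernel_poincare hβ0 hβ hm hmean

end ParticleSums

end APLG

open APLG in
theorem proposition5p6_general (α' : ℝ) (hα1 : α' < 1) :
    ∃ C : ℝ, ∀ (n : ℕ) (K : CanonicalState n), K.alphaA + K.alphaP ≤ α' →
      ∀ F, IsParticleSum F → K.expect F = 0 →
        K.expect (fun η => F η ^ 2) ≤ C * (n : ℝ) ^ 2 * dirichletForm K F := by
  refine ⟨2 * (16 * 3456 * (1 + 2 * 3456 ^ 2) / (1 - α')), fun n K hα F hF hmean => ?_⟩
  obtain ⟨ξ, hξ⟩ := K.hyperplane_nonempty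
  rw [K.expect_eq hξ, div_eq_zero_iff, or_iff_left (by positivity)] at hmean
  have hpoincare := hF.sum_sq_le (sub_pos.2 hα1) (K.card_compl_occ_ge hα hξ) hmean
  rw [K.expect_eq hξ, dirichletForm_eq K hξ, mul_div_assoc', mul_div_assoc']
  gcongr
  linarith

theorem proposition5p6 (α' : ℝ) (hα0 : 0 ≤ α') (hα1 : α' < 1) :
    ∃ C : ℝ, ∀ (ω : Real.Angle → ℝ) (n : ℕ) (K : APLG.CanonicalState n),
      K.alphaA + K.alphaP ≤ α' →
      ∀ f ∈ APLG.classTn ω n,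
        K.expect (APLG.onBox n f) = 0 →
        K.expect (fun η => APLG.onBox n f η ^ 2)
          ≤ C * (n : ℝ) ^ 2 * APLG.dirichletForm K (APLG.onBox n f) :=
  let ⟨C, hC⟩ := proposition5p6_general α' hα1
  ⟨C, fun _ n K hα _ hf => hC n K hα _ (APLG.isParticleSum_onBox hf.1 n)⟩
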